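/- Let $J\subset\mathbb R$ be a bounded open interval and let $D=\bigcup_k I_k\subset J$ be a finite or countable union of pairwise disjoint open intervals (the connected components of $D$), one of which, $I_0$, contains a point $c$. Let $g:D\to J$ be a $C^3$ map such that: for $k\neq 0$, $g|I_k$ is a diffeomorphism onto $J$; $c$ is the only critical point of $g$, and $g''(c)\ne 0$; $g(x)$ tends to one and the same endpoint of $J$ as $x\in I_0$ tends to either endpoint of $I_0$; and $g$ has negative Schwarzian derivative, $\frac{g'''}{g'}-\frac32\left(\frac{g''}{g'}\right)^2<0$ on $D\setminus\{c\}$. Assume that $g^m(c)\in D$ for all $m\ge 0$ and that $c$ is recurrent, i.e. $c$ is an accumulation point of the sequence $(g^m(c))_{m\ge0}$. Put $I^0=J$ and $g_1=g$. Given $g_n$, $n\ge1$, let $I^n$ be the component of the domain of $g_n$ that contains $c$, and let $g_{n+1}$ be the first return map of $g_n$ to $I^n$, restricted to those components of its domain of definition that meet the orbit of $c$. So $g_{n}$ maps a disjoint union $\bigcup_k I^{n}_k$ of intervals with $I^n_0=I^n$ into $I^{n-1}$. Let $\mu_n=|I^n|/|I^{n-1}|$, $n\ge1$, be the scaling factors.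 For $l\ge0$ and $n\ge l+1$ let the $l$-order $$\mathrm{ord}^n_l=\min\{p\ge1:\ g_{n-l}^{\,p}(c)\in I^n\}$$ be the return time of the $g_{n-l}$-orbit of $c$ back to $I^n$. Assume that there are no central returns, i.e. $g_n(c)\notin I^n$ for all $n\ge1$, and that the scaling factors stay away from $0$: there is $\delta>0$ with $\mu_n\ge\delta$ for all $n\ge1$. Then for each $l\ge0$ the $l$-orders are uniformly bounded over all levels: there is a constant $C$ (depending on $l$ but not on $n$) such that $\mathrm{ord}^n_l\le C$ for all $n\ge l+1$. -/

import Mathlib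

open Set Filter Topology MeasureTheory

noncomputable section

/-- The Schwarzian derivative `f''' / f' - (3/2) (f'' / f')^2`. -/
def schwarzian (f : ℝ → ℝ) (x : ℝ) : ℝ :=
  iteratedDeriv 3 f x / deriv f x - 3 / 2 * (iteratedDeriv 2 f x / deriv f x) ^ 2

/-- A partially defined map `g : ⋃ I_k → J` of the line. `target` is `J`, `dom` is `⋃ I_k`;
the values of `toFun` off `dom` are irrelevant. The intervals `I_k` are the connected components
of `dom` (all intervals are taken open, so that closures of different `I_k` may touch). -/
structure PartialMap where
  target : Set ℝ
  dom : Set ℝ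
  toFun : ℝ → ℝ

namespace PartialMap

/-- The interval `I_k` that contains `x`. -/
def piece (g : PartialMap) (x : ℝ) : Set ℝ := connectedComponentIn g.dom x

/-- The first `p` steps of the orbit of `x` are defined, `p ≥ 1`, and `g^p x ∈ A`. -/
def IsReturn (g : PartialMap) (A : Set ℝ) (x : ℝ) (p : ℕ) : Prop :=
  1 ≤ p ∧ (∀ i < p, g.toFun^[i] x ∈ g.dom) ∧ g.toFun^[p] x ∈ A

/-- The first moment `p ≥ 1` at which the `g`-orbit of `x` is in `A` (`⊤` if there is none). -/
def returnTime (g : PartialMap) (A : Set ℝ) (x : ℝ) : ℕ∞ :=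
  ⨅ (p : ℕ) (_ : g.IsReturn A x p), (p : ℕ∞)

/-- The set of points of `A` that come back to `A`. -/
def returnDom (g : PartialMap) (A : Set ℝ) : Set ℝ := {x ∈ A | ∃ p, g.IsReturn A x p}

/-- The generalized renormalization without rescaling: the first return map to the central
interval `I_0 ∋ c`, restricted to the components of its domain that meet the orbit of `c`. -/
def preRenorm (g : PartialMap) (c : ℝ) : PartialMap where
  target := g.piece c
  dom := {x ∈ g.returnDom (g.piece c) |
    ∃ m : ℕ, g.toFun^[m] c ∈ connectedComponentIn (g.returnDom (g.piece c)) x}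
  toFun := fun x => g.toFun^[(g.returnTime (g.piece c) x).toNat] x

/-- The sequence `g_1 = g`, `g_{n+1} =` pre-renormalization of `g_n` (only used for `n ≥ 1`). -/
def level (g : PartialMap) (c : ℝ) (n : ℕ) : PartialMap :=
  (fun h : PartialMap => h.preRenorm c)^[n - 1] g

/-- The nest `I^0 ⊃ I^1 ⊃ …`: `I^0 = J`, and `I^n` is the central interval of `g_n`, `n ≥ 1`. -/
def nest (g : PartialMap) (c : ℝ) : ℕ → Set ℝ
  | 0 => g.target
  | n + 1 => (g.level c (n + 1)).piece c

/-- The scaling factor `μ_n = |I^n| / |I^{n-1}|`, `n ≥ 1`. -/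
def scalingFactor (g : PartialMap) (c : ℝ) (n : ℕ) : ℝ :=
  volume.real (g.nest c n) / volume.real (g.nest c (n - 1))

/-- The `l`-order `ord^n_l`, `n - l ≥ 1`: the return time of the `g_{n-l}`-orbit of `c`
back to `I^n`. -/
def order (g : PartialMap) (c : ℝ) (l n : ℕ) : ℕ∞ :=
  (g.level c (n - l)).returnTime (g.nest c n) c

/-- Level `n ≥ 1` has a central return: `g_n c ∈ I^n`. -/
def CentralReturn (g : PartialMap) (c : ℝ) (n : ℕ) : Prop :=
  (g.level c n).toFun c ∈ g.nest c n

/-- The class `𝒯` of maps `g : ⋃ I_k → J`: every non-central branch is a diffeomorphism onto `J`,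
the central branch is unimodal with boundary going to the boundary of `J`, the only critical
point is `c`, it is non-degenerate, and the Schwarzian derivative is negative. -/
structure ClassT (g : PartialMap) (c : ℝ) : Prop where
  isOpen_dom : IsOpen g.dom
  dom_subset : g.dom ⊆ g.target
  mem_dom : c ∈ g.dom
  mapsTo : MapsTo g.toFun g.dom g.target
  contDiffOn : ContDiffOn ℝ 3 g.toFun g.dom
  deriv_eq_zero_iff : ∀ x ∈ g.dom, deriv g.toFun x = 0 ↔ x = c
  nondegenerate : iteratedDeriv 2 g.toFun c ≠ 0
  schwarzian_neg : ∀ x ∈ g.dom, x ≠ c → schwarzian g.toFun x < 0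
  branch : ∀ x ∈ g.dom, g.piece x ≠ g.piece c → BijOn g.toFun (g.piece x) g.target
  central : ∃ a b l r e : ℝ, a < b ∧ g.target = Ioo a b ∧
    l < r ∧ g.piece c = Ioo l r ∧ (e = a ∨ e = b) ∧
    Tendsto g.toFun (𝓝[>] l) (𝓝 e) ∧ Tendsto g.toFun (𝓝[<] r) (𝓝 e)

/-- The orbit of `c` never escapes the domain and accumulates at `c`. -/
def IsRecurrent (g : PartialMap) (c : ℝ) : Prop :=
  (∀ m : ℕ, g.toFun^[m] c ∈ g.dom) ∧ MapClusterPt c atTop (fun m : ℕ => g.toFun^[m] c)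

end PartialMap

end

/-- `f` does not decrease the cross ratio of four ordered points of `T`. -/
def CrossExp (f : ℝ → ℝ) (T : Set ℝ) : Prop :=
  ∀ x₁ ∈ T, ∀ x₂ ∈ T, ∀ x₃ ∈ T, ∀ x₄ ∈ T, x₁ < x₂ → x₂ < x₃ → x₃ < x₄ →
    (x₃ - x₂) * (x₄ - x₁) * (|f x₂ - f x₁| * |f x₄ - f x₃|) ≤
      |f x₃ - f x₂| * |f x₄ - f x₁| * ((x₂ - x₁) * (x₄ - x₃))

theorem CrossExp.mono {f : ℝ → ℝ} {S T : Set ℝ} (h : CrossExp f T) (hST : S ⊆ T) :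
    CrossExp f S := fun x₁ h₁ x₂ h₂ x₃ h₃ x₄ h₄ =>
  h x₁ (hST h₁) x₂ (hST h₂) x₃ (hST h₃) x₄ (hST h₄)

theorem CrossExp.congr {f g : ℝ → ℝ} {T : Set ℝ} (h : CrossExp f T) (hfg : EqOn g f T) :
    CrossExp g T := by
  intro x₁ h₁ x₂ h₂ x₃ h₃ x₄ h₄
  rw [hfg h₁, hfg h₂, hfg h₃, hfg h₄]
  exact h x₁ h₁ x₂ h₂ x₃ h₃ x₄ h₄

theorem CrossExp.neg {f : ℝ → ℝ} {T : Set ℝ} (h : CrossExp f T) :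
    CrossExp (fun x => - f x) T := by
  intro x₁ h₁ x₂ h₂ x₃ h₃ x₄ h₄ h12 h23 h34
  have e : ∀ x y, |(- f x) - (- f y)| = |f x - f y| := fun x y => by
    rw [← abs_neg]; congr 1; ring
  simp only [e]
  exact h x₁ h₁ x₂ h₂ x₃ h₃ x₄ h₄ h12 h23 h34

theorem crossRatio_le_of_affine_bounds {h₁ h₂ h₃ X Y Z a m : ℝ} (hh₁ : 0 < h₁) (hh₂ : 0 < h₂)
    (hh₃ : 0 < h₃) (hX : 0 < X) (hY : 0 < Y) (hZ : 0 < Z) (ha : 0 < a) (hb : 0 < a + m * h₂)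
    (h1 : X * (a - m * h₁) * a ≤ h₁) (h2 : h₂ ≤ Y * a * (a + m * h₂))
    (h3 : Z * (a + m * h₂) * (a + m * h₂ + m * h₃) ≤ h₃) :
    h₂ * (h₁ + h₂ + h₃) * (X * Z) ≤ Y * (X + Y + Z) * (h₁ * h₃) := by
  have i1 : h₂ * (a - m * h₁) * X ≤ Y * h₁ * (a + m * h₂) := by
    refine le_of_mul_le_mul_right ?_ ha
    nlinarith [mul_le_mul_of_nonneg_left h1 hh₂.le, mul_le_mul_of_nonneg_left h2 hh₁.le]
  have i2 : h₂ * (a + m * h₂ + m * h₃) * Z ≤ Y * h₃ * a := by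
    refine le_of_mul_le_mul_right ?_ hb
    nlinarith [mul_le_mul_of_nonneg_left h3 hh₂.le, mul_le_mul_of_nonneg_left h2 hh₃.le]
  have j1 : X * (h₁ + h₂) * a ≤ (X + Y) * h₁ * (a + m * h₂) := by nlinarith
  have j2 : Z * (h₂ + h₃) * (a + m * h₂) ≤ (Y + Z) * h₃ * a := by nlinarith
  have j3 := mul_le_mul j1 j2 (by positivity) (by positivity)
  have j4 : X * Z * ((h₁ + h₂) * (h₂ + h₃)) ≤ (X + Y) * (Y + Z) * (h₁ * h₃) := by
    refine le_of_mul_le_mul_right ?_ (mul_pos ha hb)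
    nlinarith
  nlinarith

theorem hasDerivAt_moebius {a m p y : ℝ} (hp : a + m * p ≠ 0) (hy : a + m * y ≠ 0) :
    HasDerivAt (fun y => (y - p) / ((a + m * p) * (a + m * y))) (((a + m * y) ^ 2)⁻¹) y := by
  have h1 : HasDerivAt (fun y => (a + m * p) * (a + m * y)) ((a + m * p) * m) y := by
    simpa using (((hasDerivAt_id y).const_mul m).const_add a).const_mul (a + m * p)
  have h2 := ((hasDerivAt_id' y).sub_const p).div h1 (mul_ne_zero hp hy)
  have e : ((a + m * y) ^ 2)⁻¹ = (1 * ((a + m * p) * (a + m * y)) - (y - p) * ((a + m * p) * m)) /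
      ((a + m * p) * (a + m * y)) ^ 2 := by
    field_simp
    ring
  rw [e]
  exact h2

theorem moebius_le_of_le {f φ : ℝ → ℝ} {p q a m : ℝ} (hpq : p ≤ q)
    (hf : ∀ x ∈ Icc p q, HasDerivAt f ((φ x ^ 2)⁻¹) x) (hφ : ∀ x ∈ Icc p q, 0 < φ x)
    (hl : ∀ x ∈ Icc p q, 0 < a + m * x) (h : ∀ x ∈ Icc p q, φ x ≤ a + m * x) :
    (q - p) / ((a + m * p) * (a + m * q)) ≤ f q - f p := by
  have hd : ∀ x ∈ Icc p q, HasDerivAt (fun y => f y - (y - p) / ((a + m * p) * (a + m * y)))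
      ((φ x ^ 2)⁻¹ - ((a + m * x) ^ 2)⁻¹) x := fun x hx =>
    (hf x hx).sub (hasDerivAt_moebius (hl p (left_mem_Icc.2 hpq)).ne' (hl x hx).ne')
  have hm := monotoneOn_of_hasDerivWithinAt_nonneg (convex_Icc p q)
    (fun x hx => (hd x hx).continuousAt.continuousWithinAt)
    (fun x hx => (hd x (interior_subset hx)).hasDerivWithinAt) (fun x hx => by
      have hx := interior_subset hx
      rw [sub_nonneg]
      have := hφ x hx
      have := h x hx
      gcongr)
  have := hm (left_mem_Icc.2 hpq) (right_mem_Icc.2 hpq) hpq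
  simp only [sub_self, zero_div, sub_zero] at this
  linarith

theorem le_moebius_of_le {f φ : ℝ → ℝ} {p q a m : ℝ} (hpq : p ≤ q)
    (hf : ∀ x ∈ Icc p q, HasDerivAt f ((φ x ^ 2)⁻¹) x)
    (hl : ∀ x ∈ Icc p q, 0 < a + m * x) (h : ∀ x ∈ Icc p q, a + m * x ≤ φ x) :
    f q - f p ≤ (q - p) / ((a + m * p) * (a + m * q)) := by
  have hd : ∀ x ∈ Icc p q, HasDerivAt (fun y => (y - p) / ((a + m * p) * (a + m * y)) - f y)
      (((a + m * x) ^ 2)⁻¹ - (φ x ^ 2)⁻¹) x := fun x hx =>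
    (hasDerivAt_moebius (hl p (left_mem_Icc.2 hpq)).ne' (hl x hx).ne').sub (hf x hx)
  have hm := monotoneOn_of_hasDerivWithinAt_nonneg (convex_Icc p q)
    (fun x hx => (hd x hx).continuousAt.continuousWithinAt)
    (fun x hx => (hd x (interior_subset hx)).hasDerivWithinAt) (fun x hx => by
      have hx := interior_subset hx
      rw [sub_nonneg]
      have := hl x hx
      have := h x hx
      gcongr)
  have := hm (left_mem_Icc.2 hpq) (right_mem_Icc.2 hpq) hpq
  simp only [sub_self, zero_div, zero_sub] at this
  linarith

/-- A map whose derivative is `φ⁻²` with `φ` convex and positive expands cross ratios. -/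
theorem CrossExp.of_convexOn {f φ : ℝ → ℝ} {T : Set ℝ} (hφ : ConvexOn ℝ T φ)
    (hpos : ∀ x ∈ T, 0 < φ x) (hf : ∀ x ∈ T, HasDerivAt f ((φ x ^ 2)⁻¹) x) : CrossExp f T := by
  intro x₁ h₁ x₂ h₂ x₃ h₃ x₄ h₄ h12 h23 h34
  have hT : ∀ {p q}, p ∈ T → q ∈ T → Icc p q ⊆ T := fun hp hq => hφ.1.ordConnected.out hp hq
  have hmono : ∀ {p q}, p ∈ T → q ∈ T → p < q → f p < f q := by
    intro p q hp hq hpq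
    refine strictMonoOn_of_hasDerivWithinAt_pos (f' := fun x => (φ x ^ 2)⁻¹) (convex_Icc p q)
      (fun x hx => (hf x (hT hp hq hx)).continuousAt.continuousWithinAt)
      (fun x hx => (hf x (hT hp hq (interior_subset hx))).hasDerivWithinAt)
      (fun x hx => by have := hpos x (hT hp hq (interior_subset hx)); positivity)
      (left_mem_Icc.2 hpq.le) (right_mem_Icc.2 hpq.le) hpq
  have f12 := hmono h₁ h₂ h12
  have f23 := hmono h₂ h₃ h23
  have f34 := hmono h₃ h₄ h34
  rw [abs_of_pos (by linarith), abs_of_pos (by linarith), abs_of_pos (by linarith),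
    abs_of_pos (by linarith)]
  set m := (φ x₃ - φ x₂) / (x₃ - x₂) with hm
  set a := φ x₂ - m * x₂ with ha
  have h32 : 0 < x₃ - x₂ := by linarith
  have e2 : a + m * x₂ = φ x₂ := by rw [ha]; ring
  have e3 : a + m * x₃ = φ x₃ := by
    have : m * (x₃ - x₂) = φ x₃ - φ x₂ := by rw [hm]; field_simp
    linarith
  have p2 := hpos x₂ h₂
  have p3 := hpos x₃ h₃
  have key : ∀ x, (a + m * x) * (x₃ - x₂) = φ x₂ * (x₃ - x) + φ x₃ * (x - x₂) := by
    intro x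
    have e3' : m * (x₃ - x₂) = φ x₃ - φ x₂ := by rw [hm]; field_simp
    have : (a + m * x) = φ x₂ + m * (x - x₂) := by rw [ha]; ring
    rw [this, add_mul, mul_right_comm, e3']; ring
  have hmid : ∀ x ∈ Icc x₂ x₃, φ x ≤ a + m * x := by
    intro x hx
    rcases hx.1.eq_or_lt with rfl | hx1
    · exact e2.ge
    rcases hx.2.eq_or_lt with rfl | hx2
    · exact e3.ge
    have := hφ.secant_mono_aux1 h₂ h₃ hx1 hx2
    refine le_of_mul_le_mul_right ?_ h32
    rw [key]; linarith
  have hleft : ∀ x ∈ Icc x₁ x₂, a + m * x ≤ φ x := by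
    intro x hx
    rcases hx.2.eq_or_lt with rfl | hx1
    · exact e2.le
    have := hφ.secant_mono_aux1 (hT h₁ h₂ hx) h₃ hx1 h23
    refine le_of_mul_le_mul_right ?_ h32
    rw [key]; linarith
  have hright : ∀ x ∈ Icc x₃ x₄, a + m * x ≤ φ x := by
    intro x hx
    rcases hx.1.eq_or_lt with rfl | hx1
    · exact e3.le
    have := hφ.secant_mono_aux1 h₂ (hT h₃ h₄ hx) h23 hx1
    refine le_of_mul_le_mul_right ?_ h32
    rw [key]; linarith
  have b2 : (x₃ - x₂) / (φ x₂ * φ x₃) ≤ f x₃ - f x₂ := by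
    rw [← e2, ← e3]
    exact moebius_le_of_le h23.le (fun x hx => hf x (hT h₂ h₃ hx))
      (fun x hx => hpos x (hT h₂ h₃ hx))
      (fun x hx => (hpos x (hT h₂ h₃ hx)).trans_le (hmid x hx)) hmid
  have b1 : (f x₂ - f x₁) * (a + m * x₁) * φ x₂ ≤ x₂ - x₁ := by
    rcases le_or_gt (a + m * x₁) 0 with h | h
    · have : (f x₂ - f x₁) * (a + m * x₁) ≤ 0 := mul_nonpos_of_nonneg_of_nonpos (by linarith) h
      nlinarith
    have := le_moebius_of_le (a := a) (m := m) h12.le (fun x hx => hf x (hT h₁ h₂ hx))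
      (fun x hx => by
        rcases le_or_gt 0 m with hm0 | hm0
        · nlinarith [hx.1]
        · nlinarith [hx.2]) hleft
    rw [e2, le_div_iff₀ (mul_pos h p2)] at this
    linarith
  have b3 : (f x₄ - f x₃) * φ x₃ * (a + m * x₄) ≤ x₄ - x₃ := by
    rcases le_or_gt (a + m * x₄) 0 with h | h
    · have : (f x₄ - f x₃) * φ x₃ * (a + m * x₄) ≤ 0 :=
        mul_nonpos_of_nonneg_of_nonpos (mul_nonneg (by linarith) p3.le) h
      linarith
    have := le_moebius_of_le (a := a) (m := m) h34.le (fun x hx => hf x (hT h₃ h₄ hx))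
      (fun x hx => by
        rcases le_or_gt 0 m with hm0 | hm0
        · nlinarith [hx.1]
        · nlinarith [hx.2]) hright
    rw [e3, le_div_iff₀ (mul_pos p3 h)] at this
    linarith
  rw [div_le_iff₀ (mul_pos p2 p3)] at b2
  have E3 : φ x₂ + m * (x₃ - x₂) = φ x₃ := by rw [← e2, ← e3]; ring
  have := crossRatio_le_of_affine_bounds (h₁ := x₂ - x₁) (h₂ := x₃ - x₂) (h₃ := x₄ - x₃)
    (X := f x₂ - f x₁) (Y := f x₃ - f x₂) (Z := f x₄ - f x₃) (a := φ x₂) (m := m)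
    (by linarith) (by linarith) (by linarith) (by linarith) (by linarith) (by linarith) p2
    (by rw [E3]; exact p3) (by convert b1 using 3; rw [← e2]; ring)
    (by rw [E3]; linarith) (by
      rw [E3]; convert b3 using 2; rw [← e3]; ring)
  convert this using 2 <;> ring

theorem CrossExp.of_schwarzian_neg_of_pos {f : ℝ → ℝ} {T : Set ℝ} (hT : IsOpen T)
    (hc : Convex ℝ T) (hf : ContDiffOn ℝ 3 f T) (hpos : ∀ x ∈ T, 0 < deriv f x)
    (hS : ∀ x ∈ T, schwarzian f x < 0) : CrossExp f T := by
  have hf1 : ContDiffOn ℝ 2 (deriv f) T :=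
    ((contDiffOn_succ_iff_deriv_of_isOpen hT).1 (hf : ContDiffOn ℝ (2 + 1) f T)).2.2
  have hf2 : ContDiffOn ℝ 1 (deriv (deriv f)) T :=
    ((contDiffOn_succ_iff_deriv_of_isOpen hT).1 (hf1 : ContDiffOn ℝ (1 + 1) (deriv f) T)).2.2
  have d0 : ∀ x ∈ T, HasDerivAt f (deriv f x) x := fun x hx =>
    ((hf.differentiableOn (by norm_num)).differentiableAt (hT.mem_nhds hx)).hasDerivAt
  have d1 : ∀ x ∈ T, HasDerivAt (deriv f) (deriv (deriv f) x) x := fun x hx =>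
    ((hf1.differentiableOn (by norm_num)).differentiableAt (hT.mem_nhds hx)).hasDerivAt
  have d2 : ∀ x ∈ T, HasDerivAt (deriv (deriv f)) (deriv (deriv (deriv f)) x) x := fun x hx =>
    ((hf2.differentiableOn (by norm_num)).differentiableAt (hT.mem_nhds hx)).hasDerivAt
  set u := deriv f with hu
  have p1 : ∀ x ∈ T, HasDerivAt (fun y => u y ^ (-(1 / 2) : ℝ))
      (deriv u x * (-(1 / 2)) * u x ^ (-(1 / 2) - 1 : ℝ)) x := fun x hx =>
    (d1 x hx).rpow_const (Or.inl (hpos x hx).ne')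
  have p2 : ∀ x ∈ T, HasDerivAt (fun x => deriv u x * (-(1 / 2)) * u x ^ (-(1 / 2) - 1 : ℝ))
      (deriv (deriv u) x * (-(1 / 2)) * u x ^ (-(1 / 2) - 1 : ℝ) + deriv u x * (-(1 / 2)) *
        (deriv u x * (-(1 / 2) - 1) * u x ^ (-(1 / 2) - 1 - 1 : ℝ))) x := fun x hx =>
    ((d2 x hx).mul_const _).mul ((d1 x hx).rpow_const (Or.inl (hpos x hx).ne'))
  refine CrossExp.of_convexOn (φ := fun y => u y ^ (-(1 / 2) : ℝ)) ?_
    (fun x hx => Real.rpow_pos_of_pos (hpos x hx) _) (fun x hx => ?_)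
  · refine convexOn_of_hasDerivWithinAt2_nonneg hc
      (fun x hx => (p1 x hx).continuousAt.continuousWithinAt)
      (fun x hx => (p1 x (interior_subset hx)).hasDerivWithinAt)
      (fun x hx => (p2 x (interior_subset hx)).hasDerivWithinAt) (fun x hx => ?_)
    have hx := interior_subset hx
    have h := hS x hx
    have hux := hpos x hx
    rw [schwarzian, iteratedDeriv_succ, iteratedDeriv_succ, iteratedDeriv_one, ← hu] at h
    have e1 : u x ^ (-(1 / 2) - 1 : ℝ) = u x ^ (-(1 / 2) - 1 - 1 : ℝ) * u x := by
      rw [← Real.rpow_add_one hux.ne']; norm_num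
    rw [e1]
    have hr := Real.rpow_pos_of_pos hux (-(1 / 2) - 1 - 1 : ℝ)
    set r := u x ^ (-(1 / 2) - 1 - 1 : ℝ)
    have h' : deriv (deriv u) x * u x - 3 / 2 * (deriv u x) ^ 2 < 0 := by
      have := mul_neg_of_neg_of_pos h (pow_pos hux 2)
      have e : (deriv (deriv u) x / u x - 3 / 2 * (deriv u x / u x) ^ 2) * u x ^ 2 =
        deriv (deriv u) x * u x - 3 / 2 * (deriv u x) ^ 2 := by field_simp
      rwa [e] at this
    nlinarith
  · have hux := hpos x hx
    have : ((u x ^ (-(1 / 2) : ℝ)) ^ 2)⁻¹ = u x := by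
      rw [← Real.rpow_natCast, ← Real.rpow_mul hux.le, ← Real.rpow_neg hux.le]; norm_num
    rw [this]; exact d0 x hx

theorem schwarzian_neg_fun (f : ℝ → ℝ) (x : ℝ) : schwarzian (fun y => - f y) x = schwarzian f x := by
  simp only [schwarzian, iteratedDeriv_succ, iteratedDeriv_zero, deriv.fun_neg', neg_div_neg_eq]

/-- A monotone map with negative Schwarzian derivative expands cross ratios. -/
theorem CrossExp.of_schwarzian_neg {f : ℝ → ℝ} {T : Set ℝ} (hT : IsOpen T)
    (hc : Convex ℝ T) (hf : ContDiffOn ℝ 3 f T) (hne : ∀ x ∈ T, deriv f x ≠ 0)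
    (hS : ∀ x ∈ T, schwarzian f x < 0) : CrossExp f T := by
  rcases T.eq_empty_or_nonempty with rfl | ⟨x₀, hx₀⟩
  · intro x h; exact h.elim
  have hcont : ContinuousOn (deriv f) T := hf.continuousOn_deriv_of_isOpen hT (by norm_num)
  rcases lt_or_gt_of_ne (hne x₀ hx₀) with h | h
  · have hneg : ∀ x ∈ T, deriv f x < 0 := by
      intro x hx
      by_contra hcon
      obtain ⟨y, hy, hy0⟩ := hc.isPreconnected.intermediate_value hx₀ hx hcont
        ⟨h.le, not_lt.1 hcon⟩
      exact hne y hy hy0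
    have := CrossExp.of_schwarzian_neg_of_pos (f := fun y => - f y) hT hc hf.neg
      (fun x hx => by rw [deriv.fun_neg]; linarith [hneg x hx])
      (fun x hx => by rw [schwarzian_neg_fun]; exact hS x hx)
    simpa using this.neg
  · have hpos : ∀ x ∈ T, 0 < deriv f x := by
      intro x hx
      by_contra hcon
      obtain ⟨y, hy, hy0⟩ := hc.isPreconnected.intermediate_value hx hx₀ hcont
        ⟨not_lt.1 hcon, h.le⟩
      exact hne y hy hy0
    exact CrossExp.of_schwarzian_neg_of_pos hT hc hf hpos hS

/-- `S` is a nonempty bounded open interval. -/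
def IsIoo (S : Set ℝ) : Prop := ∃ a b : ℝ, a < b ∧ S = Ioo a b

theorem Ioo_endpoints_eq {a b a' b' : ℝ} (h : a < b) (e : Ioo a b = Ioo a' b') :
    a = a' ∧ b = b' := by
  have h' : a' < b' := by rw [← nonempty_Ioo, ← e, nonempty_Ioo]; exact h
  have h1 := csInf_Ioo h
  have h2 := csSup_Ioo h
  rw [e] at h1 h2
  rw [csInf_Ioo h'] at h1
  rw [csSup_Ioo h'] at h2
  exact ⟨h1.symm, h2.symm⟩

theorem IsIoo.nonempty {S : Set ℝ} (h : IsIoo S) : S.Nonempty := by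
  obtain ⟨a, b, hab, rfl⟩ := h; exact nonempty_Ioo.2 hab

theorem IsIoo.isOpen {S : Set ℝ} (h : IsIoo S) : IsOpen S := by
  obtain ⟨a, b, hab, rfl⟩ := h; exact isOpen_Ioo

theorem IsIoo.ordConnected {S : Set ℝ} (h : IsIoo S) : S.OrdConnected := by
  obtain ⟨a, b, hab, rfl⟩ := h; exact ordConnected_Ioo

theorem IsIoo.isPreconnected {S : Set ℝ} (h : IsIoo S) : IsPreconnected S :=
  h.ordConnected.isPreconnected

theorem IsIoo.of_isOpen {S : Set ℝ} {A B : ℝ} (ho : IsOpen S) (hc : IsPreconnected S)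
    (hne : S.Nonempty) (hb : S ⊆ Ioo A B) : IsIoo S := by
  have h1 : BddBelow S := ⟨A, fun x hx => (hb hx).1.le⟩
  have h2 : BddAbove S := ⟨B, fun x hx => (hb hx).2.le⟩
  have hS : S = Ioo (sInf S) (sSup S) := by
    refine Subset.antisymm (fun x hx => ?_) ((IsConnected.Ioo_csInf_csSup_subset ⟨hne, hc⟩) h1 h2)
    obtain ⟨l, u, hlu, hsub⟩ := mem_nhds_iff_exists_Ioo_subset.1 (ho.mem_nhds hx)
    constructor
    · obtain ⟨y, hy⟩ := exists_between hlu.1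
      exact (csInf_le h1 (hsub ⟨hy.1, hy.2.trans hlu.2⟩)).trans_lt hy.2
    · obtain ⟨y, hy⟩ := exists_between hlu.2
      exact hy.1.trans_le (le_csSup h2 (hsub ⟨hlu.1.trans hy.1, hy.2⟩))
  refine ⟨_, _, ?_, hS⟩
  rw [← nonempty_Ioo, ← hS]; exact hne

/-- `f` is a homeomorphism between two bounded open intervals that expands cross ratios. -/
structure Onto (f : ℝ → ℝ) (S T : Set ℝ) : Prop where
  isIoo_left : IsIoo S
  isIoo_right : IsIoo T
  cont : ContinuousOn f S
  bij : BijOn f S T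
  cross : CrossExp f S

namespace Onto

variable {f h : ℝ → ℝ} {S T U : Set ℝ}

theorem mono_or_anti (H : Onto f S T) : StrictMonoOn f S ∨ StrictAntiOn f S := by
  obtain ⟨a, b, hab, rfl⟩ := H.isIoo_left
  exact H.cont.strictMonoOn_of_injOn_Ioo hab H.bij.injOn

theorem congr (H : Onto f S T) (e : EqOn h f S) : Onto h S T :=
  ⟨H.isIoo_left, H.isIoo_right, H.cont.congr e, H.bij.congr e.symm, H.cross.congr e⟩

theorem comp (H' : Onto h T U) (H : Onto f S T) : Onto (h ∘ f) S U := by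
  refine ⟨H.isIoo_left, H'.isIoo_right, H'.cont.comp H.cont H.bij.mapsTo, H'.bij.comp H.bij, ?_⟩
  intro x₁ h₁ x₂ h₂ x₃ h₃ x₄ h₄ h12 h23 h34
  have key : ∀ {p q P Q P' Q' : ℝ}, 0 < Q → 0 ≤ q → 0 ≤ Q' → p * Q ≤ P * q → P * Q' ≤ P' * Q →
      p * Q' ≤ P' * q := by
    intro p q P Q P' Q' hQ hq hQ' i1 i2
    refine le_of_mul_le_mul_right ?_ hQ
    nlinarith [mul_le_mul_of_nonneg_right i1 hQ', mul_le_mul_of_nonneg_right i2 hq]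
  have i1 := H.cross x₁ h₁ x₂ h₂ x₃ h₃ x₄ h₄ h12 h23 h34
  have q0 : 0 ≤ (x₂ - x₁) * (x₄ - x₃) := mul_nonneg (by linarith) (by linarith)
  rcases H.mono_or_anti with hm | hm
  · have f12 := hm h₁ h₂ h12
    have f23 := hm h₂ h₃ h23
    have f34 := hm h₃ h₄ h34
    rw [abs_of_pos (by linarith), abs_of_pos (by linarith), abs_of_pos (by linarith),
      abs_of_pos (by linarith)] at i1
    exact key (mul_pos (by linarith) (by linarith)) q0 (by positivity) i1
      (H'.cross _ (H.bij.mapsTo h₁) _ (H.bij.mapsTo h₂) _ (H.bij.mapsTo h₃) _ (H.bij.mapsTo h₄)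
        f12 f23 f34)
  · have f12 := hm h₁ h₂ h12
    have f23 := hm h₂ h₃ h23
    have f34 := hm h₃ h₄ h34
    rw [abs_of_neg (by linarith), abs_of_neg (by linarith), abs_of_neg (by linarith),
      abs_of_neg (by linarith)] at i1
    have i2 := H'.cross _ (H.bij.mapsTo h₄) _ (H.bij.mapsTo h₃) _ (H.bij.mapsTo h₂) _
      (H.bij.mapsTo h₁) f34 f23 f12
    refine key (Q := (f x₁ - f x₂) * (f x₃ - f x₄)) (P := (f x₂ - f x₃) * (f x₁ - f x₄))
      (mul_pos (by linarith) (by linarith)) q0 (by positivity) (by linarith) ?_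
    simp only [Function.comp]
    rw [abs_sub_comm (h (f x₂)) (h (f x₁)), abs_sub_comm (h (f x₄)) (h (f x₃)),
      abs_sub_comm (h (f x₃)) (h (f x₂)), abs_sub_comm (h (f x₄)) (h (f x₁))]
    linarith

theorem restrict (H : Onto f S T) (hU : IsIoo U) (hUT : U ⊆ T) : Onto f (S ∩ f ⁻¹' U) U := by
  have hbij : BijOn f (S ∩ f ⁻¹' U) U := by
    refine ⟨fun x hx => hx.2, H.bij.injOn.mono inter_subset_left, fun y hy => ?_⟩
    obtain ⟨x, hx, rfl⟩ := H.bij.surjOn (hUT hy)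
    exact ⟨x, ⟨hx, hy⟩, rfl⟩
  refine ⟨?_, hU, H.cont.mono inter_subset_left, hbij, H.cross.mono inter_subset_left⟩
  obtain ⟨a, b, hab, hS⟩ := H.isIoo_left
  refine IsIoo.of_isOpen (A := a) (B := b) (H.cont.isOpen_inter_preimage H.isIoo_left.isOpen
    hU.isOpen) ?_ ?_ (hS ▸ inter_subset_left)
  · refine OrdConnected.isPreconnected ⟨fun x hx y hy z hz => ?_⟩
    have hzS : z ∈ S := H.isIoo_left.ordConnected.out hx.1 hy.1 hz
    refine ⟨hzS, ?_⟩
    rcases H.mono_or_anti with hm | hm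
    · exact hU.ordConnected.out hx.2 hy.2 ⟨hm.monotoneOn hx.1 hzS hz.1, hm.monotoneOn hzS hy.1 hz.2⟩
    · exact hU.ordConnected.out hy.2 hx.2 ⟨hm.antitoneOn hzS hy.1 hz.2, hm.antitoneOn hx.1 hzS hz.1⟩
  · obtain ⟨y, hy⟩ := hU.nonempty
    obtain ⟨x, hx, rfl⟩ := H.bij.surjOn (hUT hy)
    exact ⟨x, hx, hy⟩

theorem neg {a b : ℝ} (H : Onto f S (Ioo a b)) : Onto (fun x => - f x) S (Ioo (-b) (-a)) := by
  obtain ⟨a', b', hab, e⟩ := H.isIoo_right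
  obtain ⟨rfl, rfl⟩ := Ioo_endpoints_eq hab e.symm
  refine ⟨H.isIoo_left, ⟨_, _, by linarith, rfl⟩, H.cont.neg, ⟨?_, ?_, ?_⟩, H.cross.neg⟩
  · intro x hx
    have := H.bij.mapsTo hx
    exact ⟨by linarith [this.2], by linarith [this.1]⟩
  · intro x hx y hy hxy
    exact H.bij.injOn hx hy (by simpa using hxy)
  · intro y hy
    obtain ⟨x, hx, hxy⟩ := H.bij.surjOn (show -y ∈ Ioo a' b' from
      ⟨by linarith [hy.2], by linarith [hy.1]⟩)
    exact ⟨x, hx, by simp [hxy]⟩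

theorem id_Ioo {a b : ℝ} (hab : a < b) : Onto (fun x => x) (Ioo a b) (Ioo a b) := by
  refine ⟨⟨_, _, hab, rfl⟩, ⟨_, _, hab, rfl⟩, continuousOn_id, bijOn_id _, ?_⟩
  intro x₁ h₁ x₂ h₂ x₃ h₃ x₄ h₄ h12 h23 h34
  rw [abs_of_pos (by linarith), abs_of_pos (by linarith), abs_of_pos (by linarith),
      abs_of_pos (by linarith)]

end Onto

theorem le_left_of_forall_Ioo {F G : ℝ → ℝ} {a e : ℝ} (hF : Continuous F) (hG : Continuous G)
    (h : ∀ y ∈ Ioo a e, F y ≤ G y) (hae : a < e) : F a ≤ G a := by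
  have : closure (Ioo a e) ⊆ {y | F y ≤ G y} := closure_minimal h (isClosed_le hF hG)
  rw [closure_Ioo hae.ne] at this
  exact this (left_mem_Icc.2 hae.le)

theorem le_right_of_forall_Ioo {F G : ℝ → ℝ} {a e : ℝ} (hF : Continuous F) (hG : Continuous G)
    (h : ∀ y ∈ Ioo a e, F y ≤ G y) (hae : a < e) : F e ≤ G e := by
  have : closure (Ioo a e) ⊆ {y | F y ≤ G y} := closure_minimal h (isClosed_le hF hG)
  rw [closure_Ioo hae.ne] at this
  exact this (right_mem_Icc.2 hae.le)

namespace Onto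

/-- The cross ratio inequality with respect to the whole interval. -/
theorem crossRatio_le {f : ℝ → ℝ} {a d a' d' b c : ℝ} (H : Onto f (Ioo a d) (Ioo a' d'))
    (hm : StrictMonoOn f (Ioo a d)) (hb : b ∈ Ioo a d) (hc : c ∈ Ioo a d) (hbc : b < c) :
    (c - b) * (d - a) * ((f b - a') * (d' - f c)) ≤
      (f c - f b) * (d' - a') * ((b - a) * (d - c)) := by
  have hfb := H.bij.mapsTo hb
  have hfc := H.bij.mapsTo hc
  have hfbc := hm hb hc hbc
  have s1 : ∀ y ∈ Ioo a' (f b), ∀ z ∈ Ioo (f c) d', (c - b) * (d - a) * ((f b - y) * (z - f c)) ≤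
      (f c - f b) * (z - y) * ((b - a) * (d - c)) := by
    intro y hy z hz
    obtain ⟨x, hx, rfl⟩ := H.bij.surjOn (show y ∈ Ioo a' d' from ⟨hy.1, hy.2.trans hfb.2⟩)
    obtain ⟨w, hw, rfl⟩ := H.bij.surjOn (show z ∈ Ioo a' d' from ⟨hfc.1.trans hz.1, hz.2⟩)
    have hxb : x < b := (hm.lt_iff_lt hx hb).1 hy.2
    have hcw : c < w := (hm.lt_iff_lt hc hw).1 hz.1
    have i := H.cross x hx b hb c hc w hw hxb hbc hcw
    have hy2 := hy.2
    have hz1 := hz.1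
    rw [abs_of_pos (by linarith), abs_of_pos (by linarith), abs_of_pos (by linarith),
      abs_of_pos (by linarith)] at i
    have hax := hx.1
    have hwd := hw.2
    have j1 : (w - a) * (b - x) ≤ (w - x) * (b - a) := by nlinarith
    have j2 : (d - a) * (w - c) ≤ (w - a) * (d - c) := by
      nlinarith [mul_nonneg (sub_nonneg.2 hwd.le) (sub_nonneg.2 hc.1.le)]
    have X0 : 0 < f b - f x := by linarith
    have Z0 : 0 < f w - f c := by linarith
    have W0 : 0 ≤ f w - f x := by linarith
    have k0 : 0 < (b - x) * (w - c) := mul_pos (by linarith) (by linarith)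
    have k1 : (d - a) * ((b - x) * (w - c)) ≤ (w - x) * ((b - a) * (d - c)) := by
      have t1 := mul_le_mul_of_nonneg_right j2 (sub_nonneg.2 hxb.le)
      have t2 := mul_le_mul_of_nonneg_right j1 (sub_nonneg.2 hc.2.le)
      nlinarith
    have k2 : 0 ≤ (c - b) * ((f b - f x) * (f w - f c)) :=
      mul_nonneg (by linarith) (mul_pos X0 Z0).le
    have k3 : 0 ≤ (b - a) * (d - c) := mul_nonneg (by linarith [hb.1]) (by linarith [hc.2])
    refine le_of_mul_le_mul_right ?_ k0
    calc (c - b) * (d - a) * ((f b - f x) * (f w - f c)) * ((b - x) * (w - c))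
        = (c - b) * ((f b - f x) * (f w - f c)) * ((d - a) * ((b - x) * (w - c))) := by ring
      _ ≤ (c - b) * ((f b - f x) * (f w - f c)) * ((w - x) * ((b - a) * (d - c))) :=
          mul_le_mul_of_nonneg_left k1 k2
      _ = (c - b) * (w - x) * ((f b - f x) * (f w - f c)) * ((b - a) * (d - c)) := by ring
      _ ≤ (f c - f b) * (f w - f x) * ((b - x) * (w - c)) * ((b - a) * (d - c)) :=
          mul_le_mul_of_nonneg_right i k3
      _ = _ := by ring
  have s2 : ∀ z ∈ Ioo (f c) d', (c - b) * (d - a) * ((f b - a') * (z - f c)) ≤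
      (f c - f b) * (z - a') * ((b - a) * (d - c)) := fun z hz =>
    le_left_of_forall_Ioo (by fun_prop) (by fun_prop) (fun y hy => s1 y hy z hz) hfb.1
  exact le_right_of_forall_Ioo (F := fun z => (c - b) * (d - a) * ((f b - a') * (z - f c)))
    (G := fun z => (f c - f b) * (z - a') * ((b - a) * (d - c))) (by fun_prop) (by fun_prop)
    s2 hfc.2

end Onto

/-- The interval `M` is `ε`-small compared with both components of `T \ M`. -/
def Space (ε : ℝ) (M T : Set ℝ) : Prop := ∃ t₁ m₁ m₂ t₂ : ℝ, M = Ioo m₁ m₂ ∧ T = Ioo t₁ t₂ ∧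
  m₁ < m₂ ∧ m₂ - m₁ ≤ ε * (m₁ - t₁) ∧ m₂ - m₁ ≤ ε * (t₂ - m₂)

theorem Space.mono_subset {ε : ℝ} (hε : 0 < ε) {M M' T T' : Set ℝ} (h : Space ε M T) (hM' : IsIoo M')
    (hT' : IsIoo T') (hM : M' ⊆ M) (hT : T ⊆ T') : Space ε M' T' := by
  obtain ⟨t₁, m₁, m₂, t₂, rfl, rfl, hm, h1, h2⟩ := h
  obtain ⟨a, b, hab, rfl⟩ := hM'
  obtain ⟨p, q, hpq, rfl⟩ := hT'
  have h1' : 0 < m₁ - t₁ := by by_contra hc; nlinarith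
  have h2' : 0 < t₂ - m₂ := by by_contra hc; nlinarith
  obtain ⟨i1, i2⟩ := (Ioo_subset_Ioo_iff hab).1 hM
  obtain ⟨i3, i4⟩ := (Ioo_subset_Ioo_iff (by linarith : t₁ < t₂)).1 hT
  refine ⟨p, a, b, q, rfl, rfl, hab, ?_, ?_⟩
  · nlinarith
  · nlinarith

theorem Space.mono {ε ε' : ℝ} (hε : 0 < ε) {M T : Set ℝ} (h : Space ε M T) (hε' : ε ≤ ε') :
    Space ε' M T := by
  obtain ⟨t₁, m₁, m₂, t₂, rfl, rfl, hm, h1, h2⟩ := h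
  have h1' : 0 < m₁ - t₁ := by by_contra hc; nlinarith
  have h2' : 0 < t₂ - m₂ := by by_contra hc; nlinarith
  exact ⟨t₁, m₁, m₂, t₂, rfl, rfl, hm, by nlinarith, by nlinarith⟩

theorem Onto.space_preimage_of_mono {f : ℝ → ℝ} {S M T : Set ℝ} {ε : ℝ} (hε : 0 < ε)
    (H : Onto f S T) (hm : StrictMonoOn f S) (h : Space ε M T) :
    Space (2 * ε + ε ^ 2) (S ∩ f ⁻¹' M) S := by
  obtain ⟨t₁, m₁, m₂, t₂, rfl, rfl, hm12, h1, h2⟩ := h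
  obtain ⟨a, d, had, rfl⟩ := H.isIoo_left
  have h1' : 0 < m₁ - t₁ := by by_contra hc; nlinarith
  have h2' : 0 < t₂ - m₂ := by by_contra hc; nlinarith
  obtain ⟨b, hb, rfl⟩ := H.bij.surjOn (show m₁ ∈ Ioo t₁ t₂ from ⟨by linarith, by linarith⟩)
  obtain ⟨c, hc, rfl⟩ := H.bij.surjOn (show m₂ ∈ Ioo t₁ t₂ from ⟨by linarith, by linarith⟩)
  have hbc : b < c := (hm.lt_iff_lt hb hc).1 hm12
  have i := H.crossRatio_le hm hb hc hbc
  have j : (f c - f b) * (t₂ - t₁) ≤ (2 * ε + ε ^ 2) * ((f b - t₁) * (t₂ - f c)) := by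
    have e : t₂ - t₁ = (f b - t₁) + (f c - f b) + (t₂ - f c) := by ring
    rw [e]
    set L := f b - t₁
    set R := t₂ - f c
    set M := f c - f b
    have := mul_le_mul h1 h2 (by simp only [M]; linarith) (by positivity)
    nlinarith
  have k : (c - b) * (d - a) ≤ (2 * ε + ε ^ 2) * ((b - a) * (d - c)) := by
    refine le_of_mul_le_mul_right ?_ (mul_pos h1' h2')
    have := mul_le_mul_of_nonneg_right j
      (mul_nonneg (sub_nonneg.2 hb.1.le) (sub_nonneg.2 hc.2.le))
    nlinarith
  have hba := hb.1
  have hcd := hc.2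
  refine ⟨a, b, c, d, ?_, rfl, hbc, ?_, ?_⟩
  · ext x
    constructor
    · rintro ⟨hx, hx1, hx2⟩
      exact ⟨(hm.lt_iff_lt hb hx).1 hx1, (hm.lt_iff_lt hx hc).1 hx2⟩
    · rintro ⟨hx1, hx2⟩
      have hx : x ∈ Ioo a d := ⟨hba.trans hx1, hx2.trans hcd⟩
      exact ⟨hx, hm hb hx hx1, hm hx hc hx2⟩
  · refine le_of_mul_le_mul_right ?_ (sub_pos.2 hcd)
    nlinarith
  · refine le_of_mul_le_mul_right ?_ (sub_pos.2 hba)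
    nlinarith

/-- Pulling back by a map that expands cross ratios preserves space. -/
theorem Onto.space_preimage {f : ℝ → ℝ} {S M T : Set ℝ} {ε : ℝ} (hε : 0 < ε)
    (H : Onto f S T) (h : Space ε M T) : Space (2 * ε + ε ^ 2) (S ∩ f ⁻¹' M) S := by
  rcases H.mono_or_anti with hm | hm
  · exact H.space_preimage_of_mono hε hm h
  · obtain ⟨t₁, m₁, m₂, t₂, rfl, rfl, hm12, h1, h2⟩ := h
    have := H.neg.space_preimage_of_mono hε hm.neg (M := Ioo (-m₂) (-m₁))
      ⟨_, _, _, _, rfl, rfl, by linarith, by linarith, by linarith⟩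
    convert this using 2
    ext x
    simp only [mem_preimage, mem_Ioo, neg_lt_neg_iff]
    tauto

/-- The increments of `f` on both sides of `c` are comparable with those of `(x - c) ^ 2`. -/
def QuadBounds (f : ℝ → ℝ) (c p q A B : ℝ) : Prop :=
  (∀ x y, c ≤ x → x ≤ y → y ≤ q → A * ((y - c) ^ 2 - (x - c) ^ 2) ≤ f y - f x ∧
    f y - f x ≤ B * ((y - c) ^ 2 - (x - c) ^ 2)) ∧
  (∀ x y, p ≤ y → y ≤ x → x ≤ c → A * ((y - c) ^ 2 - (x - c) ^ 2) ≤ f y - f x ∧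
    f y - f x ≤ B * ((y - c) ^ 2 - (x - c) ^ 2))

/-- A unimodal map `f` of `(l, r)` with a nondegenerate minimum at `c`, the same limit `E` at both
endpoints, that expands cross ratios on both sides of `c`. -/
structure Fold (f : ℝ → ℝ) (c l r E : ℝ) : Prop where
  lc : l < c
  cr : c < r
  cont : ContinuousOn f (Ioo l r)
  anti : StrictAntiOn f (Ioc l c)
  mono : StrictMonoOn f (Ico c r)
  tendsto_left : Tendsto f (𝓝[>] l) (𝓝 E)
  tendsto_right : Tendsto f (𝓝[<] r) (𝓝 E)
  cross_left : CrossExp f (Ioo l c)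
  cross_right : CrossExp f (Ioo c r)
  quad : ∀ p q, l < p → p < c → c < q → q < r → ∃ A B, 0 < A ∧ A ≤ B ∧ QuadBounds f c p q A B

theorem CrossExp.comp_neg {f : ℝ → ℝ} {a b : ℝ} (h : CrossExp f (Ioo a b)) :
    CrossExp (fun x => f (-x)) (Ioo (-b) (-a)) := by
  intro x₁ h₁ x₂ h₂ x₃ h₃ x₄ h₄ h12 h23 h34
  have m : ∀ {x}, x ∈ Ioo (-b) (-a) → -x ∈ Ioo a b := fun hx =>
    ⟨by linarith [hx.2], by linarith [hx.1]⟩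
  have := h _ (m h₄) _ (m h₃) _ (m h₂) _ (m h₁) (by linarith) (by linarith) (by linarith)
  rw [abs_sub_comm (f (-x₂)) (f (-x₁)), abs_sub_comm (f (-x₄)) (f (-x₃)),
    abs_sub_comm (f (-x₃)) (f (-x₂)), abs_sub_comm (f (-x₄)) (f (-x₁))]
  linarith

theorem QuadBounds.reflect {f : ℝ → ℝ} {c p q A B : ℝ} (h : QuadBounds f c p q A B) :
    QuadBounds (fun x => f (-x)) (-c) (-q) (-p) A B := by
  have e : ∀ x, (x - -c) ^ 2 = (-x - c) ^ 2 := fun x => by ring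
  simp only [QuadBounds, e]
  exact ⟨fun x y h1 h2 h3 => h.2 (-x) (-y) (by linarith) (by linarith) (by linarith),
    fun x y h1 h2 h3 => h.1 (-x) (-y) (by linarith) (by linarith) (by linarith)⟩

theorem QuadBounds.mono {f : ℝ → ℝ} {c p q p' q' A B : ℝ} (h : QuadBounds f c p q A B)
    (hp : p ≤ p') (hq : q' ≤ q) : QuadBounds f c p' q' A B :=
  ⟨fun x y h1 h2 h3 => h.1 x y h1 h2 (h3.trans hq), fun x y h1 h2 h3 => h.2 x y (hp.trans h1) h2 h3⟩

theorem sub_le_of_sq_sub_sq_le {X Y R k : ℝ} (hX : 0 ≤ X) (hXY : X ≤ Y) (hYR : Y ≤ R) (hk : 0 ≤ k)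
    (h : Y ^ 2 - X ^ 2 ≤ k * (R ^ 2 - Y ^ 2)) :
    Y - X ≤ (√(3 * k) + 3 * k) * (R - Y) := by
  have hs := Real.sqrt_nonneg (3 * k)
  rcases le_or_gt (2 * Y) R with hR | hR
  · have h1 : (Y - X) ^ 2 ≤ (√(3 * k) * (R - Y)) ^ 2 := by
      rw [mul_pow, Real.sq_sqrt (by positivity)]
      have : R ^ 2 - Y ^ 2 ≤ 3 * (R - Y) ^ 2 := by nlinarith
      nlinarith [mul_le_mul_of_nonneg_left this hk]
    have h2 := abs_le_of_sq_le_sq' h1 (mul_nonneg hs (by linarith))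
    have h3 : 0 ≤ 3 * k * (R - Y) := mul_nonneg (by positivity) (by linarith)
    linarith [h2.2]
  · have hY : 0 < Y := by linarith
    have h1 : (Y - X) * Y ≤ 3 * k * (R - Y) * Y := by
      have : R ^ 2 - Y ^ 2 ≤ 3 * (R - Y) * Y := by nlinarith
      nlinarith [mul_le_mul_of_nonneg_left this hk]
    have h2 := le_of_mul_le_mul_right h1 hY
    have h3 : 0 ≤ √(3 * k) * (R - Y) := mul_nonneg hs (by linarith)
    linarith

/-- The loss of space in a pull-back by a nondegenerate fold. -/
noncomputable def foldLoss (k ε : ℝ) : ℝ := 6 * k * (1 + 2 * k ^ 2) * (√ε + ε)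

theorem sqrt_add_le_foldLoss {k ε : ℝ} (hk : 1 ≤ k) (hε : 0 < ε) :
    (√(3 * (k * ε)) + 3 * (k * ε)) * (1 + 2 * k ^ 2) ≤ foldLoss k ε := by
  have h1 : √(3 * (k * ε)) ≤ 3 * k * √ε := by
    rw [← mul_assoc, Real.sqrt_mul (by positivity)]
    gcongr
    rw [Real.sqrt_le_left (by positivity)]
    nlinarith
  have hs := Real.sqrt_nonneg ε
  have h2 : √(3 * (k * ε)) + 3 * (k * ε) ≤ 6 * k * (√ε + ε) := by
    have : 0 ≤ k * √ε := by positivity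
    have : 0 ≤ k * ε := by positivity
    linarith
  have := mul_le_mul_of_nonneg_right h2 (by positivity : 0 ≤ 1 + 2 * k ^ 2)
  rw [foldLoss]
  linarith

namespace Fold

variable {f : ℝ → ℝ} {c l r E : ℝ}

theorem reflect (F : Fold f c l r E) : Fold (fun x => f (-x)) (-c) (-r) (-l) E where
  lc := by linarith [F.cr]
  cr := by linarith [F.lc]
  cont := F.cont.comp continuousOn_neg fun x hx => ⟨by linarith [hx.2], by linarith [hx.1]⟩
  anti := fun x hx y hy hxy => F.mono ⟨by linarith [hy.2], by linarith [hy.1]⟩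
    ⟨by linarith [hx.2], by linarith [hx.1]⟩ (by linarith)
  mono := fun x hx y hy hxy => F.anti ⟨by linarith [hy.2], by linarith [hy.1]⟩
    ⟨by linarith [hx.2], by linarith [hx.1]⟩ (by linarith)
  tendsto_left := F.tendsto_right.comp (by simpa using tendsto_neg_nhdsGT (a := -r))
  tendsto_right := F.tendsto_left.comp (by simpa using tendsto_neg_nhdsLT (a := -l))
  cross_left := F.cross_right.comp_neg
  cross_right := F.cross_left.comp_neg
  quad := fun p q h1 h2 h3 h4 => by
    obtain ⟨A, B, hA, hAB, h⟩ := F.quad (-q) (-p) (by linarith) (by linarith) (by linarith)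
      (by linarith)
    exact ⟨A, B, hA, hAB, by simpa using h.reflect⟩

theorem lt_limit_right (F : Fold f c l r E) {x : ℝ} (hx : x ∈ Ico c r) : f x < E := by
  obtain ⟨y, hy⟩ := exists_between hx.2
  have hy' : y ∈ Ico c r := ⟨hx.1.trans hy.1.le, hy.2⟩
  refine (F.mono hx hy' hy.1).trans_le (ge_of_tendsto F.tendsto_right ?_)
  filter_upwards [Ioo_mem_nhdsLT hy.2] with z hz
  exact (F.mono hy' ⟨hy'.1.trans hz.1.le, hz.2⟩ hz.1).le

theorem onto_right (F : Fold f c l r E) : Onto f (Ioo c r) (Ioo (f c) E) := by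
  have hc : c ∈ Ico c r := ⟨le_rfl, F.cr⟩
  have hsub : Ioo c r ⊆ Ico c r := Ioo_subset_Ico_self
  refine ⟨⟨_, _, F.cr, rfl⟩, ⟨_, _, F.lt_limit_right hc, rfl⟩,
    F.cont.mono (Ioo_subset_Ioo_left F.lc.le), ⟨?_, (F.mono.mono hsub).injOn, ?_⟩, F.cross_right⟩
  · exact fun x hx => ⟨F.mono hc (hsub hx) hx.1, F.lt_limit_right (hsub hx)⟩
  · intro v hv
    obtain ⟨z, hvz, hz⟩ := ((F.tendsto_right.eventually (lt_mem_nhds hv.2)).and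
      (Ioo_mem_nhdsLT F.cr)).exists
    have hcont : ContinuousOn f (Icc c z) :=
      F.cont.mono fun y hy => ⟨F.lc.trans_le hy.1, hy.2.trans_lt hz.2⟩
    obtain ⟨y, hy, rfl⟩ := intermediate_value_Ioo hz.1.le hcont ⟨hv.1, hvz⟩
    exact ⟨y, ⟨hy.1, hy.2.trans hz.2⟩, rfl⟩

theorem onto_left (F : Fold f c l r E) : Onto f (Ioo l c) (Ioo (f c) E) := by
  have h := F.reflect.onto_right
  simp only [neg_neg] at h
  refine ⟨⟨_, _, F.lc, rfl⟩, h.isIoo_right, F.cont.mono (Ioo_subset_Ioo_right F.cr.le),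
    ⟨?_, (F.anti.mono Ioo_subset_Ioc_self).injOn, ?_⟩, F.cross_left⟩
  · intro x hx
    have := h.bij.mapsTo (show -x ∈ Ioo (-c) (-l) from ⟨by linarith [hx.2], by linarith [hx.1]⟩)
    simpa using this
  · intro v hv
    obtain ⟨y, hy, rfl⟩ := h.bij.surjOn hv
    exact ⟨-y, ⟨by linarith [hy.2], by linarith [hy.1]⟩, rfl⟩

theorem cases_mem (F : Fold f c l r E) {x : ℝ} (hx : x ∈ Ioo l r) :
    x = c ∨ (x ∈ Ioo l c ∧ f x ∈ Ioo (f c) E) ∨ (x ∈ Ioo c r ∧ f x ∈ Ioo (f c) E) := by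
  rcases lt_trichotomy x c with h | h | h
  · exact Or.inr (Or.inl ⟨⟨hx.1, h⟩, F.onto_left.bij.mapsTo ⟨hx.1, h⟩⟩)
  · exact Or.inl h
  · exact Or.inr (Or.inr ⟨⟨h, hx.2⟩, F.onto_right.bij.mapsTo ⟨h, hx.2⟩⟩)

theorem mem_c (F : Fold f c l r E) : c ∈ Ioo l r := ⟨F.lc, F.cr⟩

theorem lt_limit (F : Fold f c l r E) {x : ℝ} (hx : x ∈ Ioo l r) : f x < E := by
  rcases F.cases_mem hx with rfl | h | h
  · exact F.lt_limit_right ⟨le_rfl, F.cr⟩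
  · exact h.2.2
  · exact h.2.2

theorem min_le (F : Fold f c l r E) {x : ℝ} (hx : x ∈ Ioo l r) : f c ≤ f x := by
  rcases F.cases_mem hx with rfl | h | h
  · rfl
  · exact h.2.1.le
  · exact h.2.1.le

theorem exists_right (F : Fold f c l r E) {w : ℝ} (hw : f c < w) (hwE : w < E) :
    ∃ q, c < q ∧ q < r ∧ f q = w ∧ ∀ x ∈ Ico c r, f x < w ↔ x < q := by
  obtain ⟨q, hq, rfl⟩ := F.onto_right.bij.surjOn (show w ∈ Ioo (f c) E from ⟨hw, hwE⟩)
  exact ⟨q, hq.1, hq.2, rfl, fun x hx => F.mono.lt_iff_lt hx (Ioo_subset_Ico_self hq)⟩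

theorem exists_left (F : Fold f c l r E) {w : ℝ} (hw : f c < w) (hwE : w < E) :
    ∃ p, l < p ∧ p < c ∧ f p = w ∧ ∀ x ∈ Ioc l c, f x < w ↔ p < x := by
  obtain ⟨p, hp, rfl⟩ := F.onto_left.bij.surjOn (show w ∈ Ioo (f c) E from ⟨hw, hwE⟩)
  exact ⟨p, hp.1, hp.2, rfl, fun x hx => F.anti.lt_iff_gt hx (Ioo_subset_Ioc_self hp)⟩

/-- Sublevel sets of a fold are intervals. -/
theorem sublevel (F : Fold f c l r E) {w : ℝ} (hw : f c < w) (hwE : w < E) :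
    ∃ p q, l < p ∧ p < c ∧ c < q ∧ q < r ∧ f p = w ∧ f q = w ∧
      {x ∈ Ioo l r | f x < w} = Ioo p q := by
  obtain ⟨q, cq, qr, fq, hq⟩ := F.exists_right hw hwE
  obtain ⟨p, lp, pc, fp, hp⟩ := F.exists_left hw hwE
  refine ⟨p, q, lp, pc, cq, qr, fp, fq, ?_⟩
  ext x
  constructor
  · rintro ⟨hx, hxw⟩
    rcases le_total x c with h | h
    · exact ⟨(hp x ⟨hx.1, h⟩).1 hxw, h.trans_lt cq⟩
    · exact ⟨pc.trans_le h, (hq x ⟨h, hx.2⟩).1 hxw⟩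
  · rintro ⟨h1, h2⟩
    have hx : x ∈ Ioo l r := ⟨lp.trans h1, h2.trans qr⟩
    rcases le_total x c with h | h
    · exact ⟨hx, (hp x ⟨hx.1, h⟩).2 h1⟩
    · exact ⟨hx, (hq x ⟨h, hx.2⟩).2 h2⟩

theorem sublevel_limit (F : Fold f c l r E) : {x ∈ Ioo l r | f x < E} = Ioo l r := by
  ext x; exact ⟨fun h => h.1, fun h => ⟨h, F.lt_limit h⟩⟩

theorem isIoo_sublevel (F : Fold f c l r E) {w : ℝ} (hw : f c < w) (hwE : w ≤ E) :
    IsIoo {x ∈ Ioo l r | f x < w} := by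
  rcases hwE.eq_or_lt with rfl | h
  · rw [F.sublevel_limit]; exact ⟨l, r, F.lc.trans F.cr, rfl⟩
  · obtain ⟨p, q, -, h1, h2, -, -, -, h3⟩ := F.sublevel hw h
    exact ⟨p, q, h1.trans h2, h3⟩

/-- Endpoints of a symmetric interval are at comparable distances from `c`. -/
theorem dist_comparable {p q w A B : ℝ} (hA : 0 < A) (hAB : A ≤ B) (Q : QuadBounds f c p q A B)
    (hpc : p < c) (hcq : c < q) (hp : f p = w) (hq : f q = w) :
    q - c ≤ B / A * (c - p) ∧ c - p ≤ B / A * (q - c) := by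
  obtain ⟨a1, a2⟩ := Q.1 c q le_rfl hcq.le le_rfl
  obtain ⟨b1, b2⟩ := Q.2 c p le_rfl hpc.le le_rfl
  rw [hq] at a1 a2
  rw [hp] at b1 b2
  have k1 : 1 ≤ B / A := by rw [le_div_iff₀ hA]; linarith
  have hB : B = B / A * A := by field_simp
  set k := B / A
  have c1 : (q - c) ^ 2 ≤ k * (c - p) ^ 2 := by
    refine le_of_mul_le_mul_left ?_ hA
    have : A * ((q - c) ^ 2) ≤ k * A * (c - p) ^ 2 := by rw [← hB]; linarith
    linarith
  have c2 : (c - p) ^ 2 ≤ k * (q - c) ^ 2 := by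
    refine le_of_mul_le_mul_left ?_ hA
    have : A * ((c - p) ^ 2) ≤ k * A * (q - c) ^ 2 := by rw [← hB]; linarith
    linarith
  have k2 : k ≤ k ^ 2 := by nlinarith
  constructor
  · refine abs_le_of_sq_le_sq' ?_ (mul_nonneg (by linarith) (by linarith)) |>.2
    rw [mul_pow]
    exact c1.trans (mul_le_mul_of_nonneg_right k2 (sq_nonneg _))
  · refine abs_le_of_sq_le_sq' ?_ (mul_nonneg (by linarith) (by linarith)) |>.2
    rw [mul_pow]
    exact c2.trans (mul_le_mul_of_nonneg_right k2 (sq_nonneg _))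

/-- The outer gap of a pull-back on the right of `c`. -/
theorem right_gap {p q w A B ε x y : ℝ} (hA : 0 < A) (hAB : A ≤ B) (hε : 0 < ε)
    (Q : QuadBounds f c p q A B) (hq : f q = w) (hcx : c ≤ x) (hxy : x ≤ y) (hyq : y ≤ q)
    (h : f y - f x ≤ ε * (w - f y)) :
    y - x ≤ (√(3 * (B / A * ε)) + 3 * (B / A * ε)) * (q - y) := by
  have a := (Q.1 x y hcx hxy hyq).1
  have b := (Q.1 y q (hcx.trans hxy) hyq le_rfl).2
  rw [hq] at b
  have := sub_le_of_sq_sub_sq_le (X := x - c) (Y := y - c) (R := q - c) (k := B / A * ε)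
    (by linarith) (by linarith) (by linarith) (by have := hA.trans_le hAB; positivity) (by
      refine le_of_mul_le_mul_left ?_ hA
      have e : A * (B / A * ε * ((q - c) ^ 2 - (y - c) ^ 2)) =
        ε * (B * ((q - c) ^ 2 - (y - c) ^ 2)) := by field_simp
      rw [e]
      exact a.trans (h.trans (mul_le_mul_of_nonneg_left b hε.le)))
  simpa using this

theorem space_right (F : Fold f c l r E) {p q w A B ε u m₁ m₂ : ℝ} (hA : 0 < A) (hAB : A ≤ B)
    (hε : 0 < ε) (Q : QuadBounds f c p q A B) (hpc : p < c) (hcq : c < q) (hqr : q < r)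
    (hp : f p = w) (hq : f q = w) (hM : Space ε (Ioo m₁ m₂) (Ioo u w))
    (huw : u < w) (hm₁ : f c ≤ m₁) :
    Space (foldLoss (B / A) ε) (Ioo c r ∩ f ⁻¹' Ioo m₁ m₂) (Ioo p q) := by
  obtain ⟨t₁, n₁, n₂, t₂, e1, e2, hm12, h1, h2⟩ := hM
  obtain ⟨rfl, rfl⟩ := Ioo_endpoints_eq hm12 e1.symm
  obtain ⟨rfl, rfl⟩ := Ioo_endpoints_eq huw e2
  have h2' : 0 < w - n₂ := by by_contra hc; nlinarith
  have hwE : w < E := by rw [← hq]; exact F.lt_limit_right ⟨hcq.le, hqr⟩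
  have hqI : q ∈ Ico c r := ⟨hcq.le, hqr⟩
  obtain ⟨y, cy, yr, fy, hy⟩ := F.exists_right (hm₁.trans_lt hm12) (by linarith : n₂ < E)
  have hyI : y ∈ Ico c r := ⟨cy.le, yr⟩
  have yq : y < q := by rw [← F.mono.lt_iff_lt hyI hqI]; linarith
  obtain ⟨x, cx, xr, fx, hx⟩ : ∃ x, c ≤ x ∧ x < r ∧ f x = n₁ ∧
      ∀ z ∈ Ioo c r, n₁ < f z ↔ x < z := by
    rcases hm₁.eq_or_lt with h | h
    · refine ⟨c, le_rfl, F.cr, h, fun z hz => ?_⟩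
      rw [← h]
      exact F.mono.lt_iff_lt ⟨le_rfl, F.cr⟩ (Ioo_subset_Ico_self hz)
    · obtain ⟨x, cx, xr, fx, hx⟩ := F.exists_right h (by linarith : n₁ < E)
      refine ⟨x, cx.le, xr, fx, fun z hz => ?_⟩
      rw [← fx]
      exact F.mono.lt_iff_lt ⟨cx.le, xr⟩ (Ioo_subset_Ico_self hz)
  have xy : x < y := by rw [← F.mono.lt_iff_lt ⟨cx, xr⟩ hyI]; linarith
  have g := right_gap hA hAB hε Q hq cx xy.le yq.le (by rw [fy, fx]; linarith)
  have k1 : 1 ≤ B / A := by rw [le_div_iff₀ hA]; linarith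
  have hl := sqrt_add_le_foldLoss k1 hε
  have d := (dist_comparable hA hAB Q hpc hcq hp hq).1
  set k := B / A
  set φ := √(3 * (k * ε)) + 3 * (k * ε)
  have hφ : 0 ≤ φ := by have := Real.sqrt_nonneg (3 * (k * ε)); positivity
  refine ⟨p, x, y, q, ?_, rfl, xy, ?_, ?_⟩
  · ext z
    constructor
    · rintro ⟨hz, hz1, hz2⟩
      exact ⟨(hx z hz).1 hz1, (hy z (Ioo_subset_Ico_self hz)).1 hz2⟩
    · rintro ⟨h3, h4⟩
      have hz : z ∈ Ioo c r := ⟨cx.trans_lt h3, h4.trans yr⟩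
      exact ⟨hz, (hx z hz).2 h3, (hy z (Ioo_subset_Ico_self hz)).2 h4⟩
  · calc y - x ≤ φ * (q - y) := g
      _ ≤ φ * (k * (c - p)) := by gcongr; linarith
      _ = φ * k * (c - p) := by ring
      _ ≤ φ * (1 + 2 * k ^ 2) * (x - p) := by
        have : k ≤ 1 + 2 * k ^ 2 := by nlinarith
        gcongr
      _ ≤ foldLoss k ε * (x - p) := by gcongr; linarith
  · calc y - x ≤ φ * (q - y) := g
      _ ≤ φ * (1 + 2 * k ^ 2) * (q - y) := by
        have : φ ≤ φ * (1 + 2 * k ^ 2) := by nlinarith [mul_nonneg hφ (sq_nonneg k)]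
        gcongr
      _ ≤ foldLoss k ε * (q - y) := by gcongr

theorem space_left (F : Fold f c l r E) {p q w A B ε u m₁ m₂ : ℝ} (hA : 0 < A) (hAB : A ≤ B)
    (hε : 0 < ε) (Q : QuadBounds f c p q A B) (hlp : l < p) (hpc : p < c) (hcq : c < q)
    (hp : f p = w) (hq : f q = w) (hM : Space ε (Ioo m₁ m₂) (Ioo u w))
    (huw : u < w) (hm₁ : f c ≤ m₁) :
    Space (foldLoss (B / A) ε) (Ioo l c ∩ f ⁻¹' Ioo m₁ m₂) (Ioo p q) := by
  obtain ⟨t₁, x, y, t₂, e1, e2, h1, h2, h3⟩ := F.reflect.space_right hA hAB hε Q.reflect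
    (neg_lt_neg hcq) (neg_lt_neg hpc) (neg_lt_neg hlp) (by simpa using hq) (by simpa using hp) hM
    huw (by simpa using hm₁)
  obtain ⟨rfl, rfl⟩ := Ioo_endpoints_eq (by linarith) e2
  refine ⟨p, -y, -x, q, ?_, rfl, by linarith, by linarith, by linarith⟩
  ext z
  have : -z ∈ Ioo (-c) (-l) ∩ (fun x => f (-x)) ⁻¹' Ioo m₁ m₂ ↔ -z ∈ Ioo x y := by rw [e1]
  simp only [mem_inter_iff, mem_Ioo, mem_preimage, neg_neg, neg_lt_neg_iff] at this
  simp only [mem_inter_iff, mem_Ioo, mem_preimage]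
  constructor
  · rintro ⟨⟨i1, i2⟩, i3⟩
    have := this.1 ⟨⟨i2, i1⟩, i3⟩
    exact ⟨by linarith, by linarith⟩
  · rintro ⟨i1, i2⟩
    have := this.2 ⟨by linarith, by linarith⟩
    exact ⟨⟨this.1.2, this.1.1⟩, this.2⟩

theorem space_center (F : Fold f c l r E) {p q w A B ε u m₁ m₂ : ℝ} (hA : 0 < A) (hAB : A ≤ B)
    (hε : 0 < ε) (Q : QuadBounds f c p q A B) (hlp : l < p) (hpc : p < c) (hcq : c < q) (hqr : q < r)
    (hp : f p = w) (hq : f q = w) (hM : Space ε (Ioo m₁ m₂) (Ioo u w))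
    (huw : u < w) (hm : f c ∈ Ioo m₁ m₂) :
    Space (foldLoss (B / A) ε) {z ∈ Ioo l r | f z < m₂} (Ioo p q) := by
  obtain ⟨t₁, n₁, n₂, t₂, e1, e2, hm12, h1, h2⟩ := hM
  obtain ⟨rfl, rfl⟩ := Ioo_endpoints_eq hm12 e1.symm
  obtain ⟨rfl, rfl⟩ := Ioo_endpoints_eq huw e2
  have h2' : 0 < w - n₂ := by by_contra hc; nlinarith
  have hwE : w < E := by rw [← hq]; exact F.lt_limit_right ⟨hcq.le, hqr⟩
  obtain ⟨x, y, lx, xc, cy, yr, fx, fy, hset⟩ := F.sublevel hm.2 (by linarith : n₂ < E)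
  have yq : y < q := by rw [← F.mono.lt_iff_lt ⟨cy.le, yr⟩ ⟨hcq.le, hqr⟩]; linarith
  have px : p < x := by rw [← F.anti.lt_iff_gt ⟨lx, xc.le⟩ ⟨hlp, hpc.le⟩]; linarith
  have hm1 := hm.1
  have g1 := right_gap hA hAB hε Q hq le_rfl cy.le yq.le (by rw [fy]; linarith)
  have g2 := right_gap hA hAB hε Q.reflect (x := -c) (y := -x) (w := w) (by simpa using hp) le_rfl
    (by linarith) (by linarith) (by simp only [neg_neg]; rw [fx]; linarith)
  have k1 : 1 ≤ B / A := by rw [le_div_iff₀ hA]; linarith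
  have hl := sqrt_add_le_foldLoss k1 hε
  obtain ⟨d1, d2⟩ := dist_comparable hA hAB Q hpc hcq hp hq
  have hB : B = B / A * A := by field_simp
  obtain ⟨a1, a2⟩ := Q.1 y q cy.le yq.le le_rfl
  obtain ⟨b1, b2⟩ := Q.2 x p le_rfl px.le xc.le
  rw [hq, fy] at a1 a2
  rw [hp, fx] at b1 b2
  set k := B / A
  have c1 : (q - c) ^ 2 - (y - c) ^ 2 ≤ k * ((p - c) ^ 2 - (x - c) ^ 2) := by
    refine le_of_mul_le_mul_left ?_ hA
    rw [← mul_assoc, mul_comm A k, ← hB]; linarith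
  have c2 : (p - c) ^ 2 - (x - c) ^ 2 ≤ k * ((q - c) ^ 2 - (y - c) ^ 2) := by
    refine le_of_mul_le_mul_left ?_ hA
    rw [← mul_assoc, mul_comm A k, ← hB]; linarith
  have s1 : q - y ≤ 2 * k ^ 2 * (x - p) := by
    refine le_of_mul_le_mul_right ?_ (sub_pos.2 hcq)
    calc (q - y) * (q - c) ≤ (q - c) ^ 2 - (y - c) ^ 2 := by
          nlinarith only [mul_nonneg (sub_nonneg.2 yq.le) (sub_nonneg.2 cy.le)]
      _ ≤ k * ((p - c) ^ 2 - (x - c) ^ 2) := c1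
      _ = k * ((x - p) * ((c - x) + (c - p))) := by ring
      _ ≤ k * ((x - p) * (2 * (c - p))) := by gcongr; linarith
      _ ≤ k * ((x - p) * (2 * (k * (q - c)))) := by gcongr
      _ = _ := by ring
  have s2 : x - p ≤ 2 * k ^ 2 * (q - y) := by
    refine le_of_mul_le_mul_right ?_ (sub_pos.2 hpc)
    calc (x - p) * (c - p) ≤ (p - c) ^ 2 - (x - c) ^ 2 := by
          nlinarith only [mul_nonneg (sub_nonneg.2 px.le) (sub_nonneg.2 xc.le)]
      _ ≤ k * ((q - c) ^ 2 - (y - c) ^ 2) := c2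
      _ = k * ((q - y) * ((y - c) + (q - c))) := by ring
      _ ≤ k * ((q - y) * (2 * (q - c))) := by gcongr; linarith
      _ ≤ k * ((q - y) * (2 * (k * (c - p)))) := by gcongr
      _ = _ := by ring
  set φ := √(3 * (k * ε)) + 3 * (k * ε)
  have hφ : 0 ≤ φ := by have := Real.sqrt_nonneg (3 * (k * ε)); positivity
  have t1 := mul_le_mul_of_nonneg_left s1 hφ
  have t2 := mul_le_mul_of_nonneg_left s2 hφ
  have r1 := mul_le_mul_of_nonneg_right hl (sub_nonneg.2 px.le)
  have r2 := mul_le_mul_of_nonneg_right hl (sub_nonneg.2 yq.le)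
  refine ⟨p, x, y, q, hset, rfl, xc.trans cy, ?_, ?_⟩ <;> linarith

end Fold

namespace PartialMap

/-- `q` is the first moment at which the orbit of `x` comes to `A`. -/
def IsFirst (G : PartialMap) (A : Set ℝ) (x : ℝ) (q : ℕ) : Prop :=
  G.IsReturn A x q ∧ ∀ p < q, ¬ G.IsReturn A x p

theorem IsReturn.exists_isFirst {G : PartialMap} {A : Set ℝ} {x : ℝ} {p : ℕ}
    (h : G.IsReturn A x p) : ∃ q ≤ p, G.IsFirst A x q := by
  classical
  exact ⟨Nat.find ⟨p, h⟩, Nat.find_min' _ h, Nat.find_spec ⟨p, h⟩, fun m hm => Nat.find_min _ hm⟩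

theorem IsFirst.returnTime_eq {G : PartialMap} {A : Set ℝ} {x : ℝ} {q : ℕ}
    (h : G.IsFirst A x q) : G.returnTime A x = q := by
  refine le_antisymm (iInf₂_le q h.1) (le_iInf₂ fun p hp => ?_)
  exact_mod_cast not_lt.1 fun hlt => h.2 p hlt hp

theorem IsReturn.returnTime_le {G : PartialMap} {A : Set ℝ} {x : ℝ} {q : ℕ}
    (h : G.IsReturn A x q) : G.returnTime A x ≤ q := iInf₂_le q h

theorem IsFirst.mem_dom {G : PartialMap} {A : Set ℝ} {x : ℝ} {q i : ℕ} (h : G.IsFirst A x q)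
    (hi : i < q) : G.toFun^[i] x ∈ G.dom := h.1.2.1 i hi

theorem IsFirst.notMem {G : PartialMap} {A : Set ℝ} {x : ℝ} {q i : ℕ} (h : G.IsFirst A x q)
    (hi : i < q) (h0 : 1 ≤ i) : G.toFun^[i] x ∉ A := fun hA =>
  h.2 i hi ⟨h0, fun _ hj => h.mem_dom (hj.trans hi), hA⟩

theorem mem_returnDom_iff {G : PartialMap} {A : Set ℝ} {x : ℝ} :
    x ∈ G.returnDom A ↔ x ∈ A ∧ ∃ q, G.IsFirst A x q :=
  ⟨fun h => ⟨h.1, h.2.elim fun _ hp => hp.exists_isFirst.imp fun _ hq => hq.2⟩,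
    fun h => ⟨h.1, h.2.imp fun _ hq => hq.1⟩⟩

theorem mem_piece {G : PartialMap} {x : ℝ} (hx : x ∈ G.dom) : x ∈ G.piece x :=
  mem_connectedComponentIn hx

theorem piece_subset (G : PartialMap) (x : ℝ) : G.piece x ⊆ G.dom := connectedComponentIn_subset _ _

theorem piece_eq_of_mem {G : PartialMap} {x y : ℝ} (h : y ∈ G.piece x) : G.piece x = G.piece y :=
  connectedComponentIn_eq h

theorem notMem_piece_of_mem {G : PartialMap} {x y c : ℝ} (hx : x ∈ G.dom) (hxc : x ∉ G.piece c)
    (hy : y ∈ G.piece x) : y ∉ G.piece c := fun h => by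
  rw [piece_eq_of_mem h, ← piece_eq_of_mem hy] at hxc
  exact hxc (mem_piece hx)

/-- The points of the target whose itinerary agrees with that of `y` for `N` steps. -/
def chain (G : PartialMap) (y : ℝ) (N : ℕ) : Set ℝ :=
  {z ∈ G.target | ∀ i < N, G.toFun^[i] z ∈ G.piece (G.toFun^[i] y)}

theorem chain_zero (G : PartialMap) (y : ℝ) : G.chain y 0 = G.target := by
  simp [chain]

theorem chain_succ (G : PartialMap) (y : ℝ) (N : ℕ) : G.chain y (N + 1) =
    G.chain y N ∩ G.toFun^[N] ⁻¹' G.piece (G.toFun^[N] y) := by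
  ext z
  simp only [chain, mem_ofPred_eq, mem_inter_iff, mem_preimage, Nat.lt_succ_iff_lt_or_eq, and_assoc]
  refine and_congr_right fun _ => ⟨fun h => ⟨fun i hi => h i (Or.inl hi), h N (Or.inr rfl)⟩, ?_⟩
  rintro ⟨h1, h2⟩ i (hi | rfl)
  exacts [h1 i hi, h2]

theorem chain_antitone (G : PartialMap) (y : ℝ) {M N : ℕ} (h : M ≤ N) :
    G.chain y N ⊆ G.chain y M := fun _ hz => ⟨hz.1, fun i hi => hz.2 i (hi.trans_le h)⟩

theorem preRenorm_piece {G : PartialMap} {c x : ℝ} (hx : x ∈ (G.preRenorm c).dom) :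
    (G.preRenorm c).piece x = connectedComponentIn (G.returnDom (G.piece c)) x := by
  refine Subset.antisymm (connectedComponentIn_mono x fun y hy => hy.1) ?_
  refine isPreconnected_connectedComponentIn.subset_connectedComponentIn
    (mem_connectedComponentIn hx.1) fun y hy => ⟨connectedComponentIn_subset _ _ hy, ?_⟩
  rw [← connectedComponentIn_eq hy]
  exact hx.2

/-- A map obtained from the fold `f` by composing with `H` on the central piece
`{f < w}`, and with full branches that expand cross ratios on the other pieces. -/
structure IsLevel (f : ℝ → ℝ) (c l r E : ℝ) (G : PartialMap) (u w : ℝ) (H : ℝ → ℝ) : Prop where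
  isIoo_target : IsIoo G.target
  isOpen_dom : IsOpen G.dom
  dom_subset : G.dom ⊆ G.target
  branch : ∀ x ∈ G.dom, x ∉ G.piece c → Onto G.toFun (G.piece x) G.target
  u_lt : u < f c
  lt_w : f c < w
  w_le : w ≤ E
  onto : Onto H (Ioo u w) G.target
  piece_eq : G.piece c = {x ∈ Ioo l r | f x < w}
  eq_comp : ∀ x ∈ G.piece c, G.toFun x = H (f x)
  isRecurrent : G.IsRecurrent c

namespace IsLevel

variable {f : ℝ → ℝ} {c l r E : ℝ} {G : PartialMap} {u w : ℝ} {H : ℝ → ℝ}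

theorem mem_dom (L : IsLevel f c l r E G u w H) : c ∈ G.dom := L.isRecurrent.1 0

theorem isOpen_piece (L : IsLevel f c l r E G u w H) (x : ℝ) : IsOpen (G.piece x) :=
  L.isOpen_dom.connectedComponentIn

theorem isIoo_piece (L : IsLevel f c l r E G u w H) {x : ℝ} (hx : x ∈ G.dom) :
    IsIoo (G.piece x) := by
  obtain ⟨a, b, -, h⟩ := L.isIoo_target
  exact IsIoo.of_isOpen (L.isOpen_piece x) isPreconnected_connectedComponentIn ⟨x, mem_piece hx⟩
    (h ▸ (G.piece_subset x).trans L.dom_subset)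

theorem apply_mem (L : IsLevel f c l r E G u w H) (F : Fold f c l r E) {x : ℝ}
    (hx : x ∈ G.piece c) : x ∈ Ioo l r ∧ f x ∈ Ioo u w := by
  rw [L.piece_eq] at hx
  exact ⟨hx.1, L.u_lt.trans_le (F.min_le hx.1), hx.2⟩

theorem mapsTo (L : IsLevel f c l r E G u w H) (F : Fold f c l r E) {x : ℝ} (hx : x ∈ G.dom) :
    G.toFun x ∈ G.target := by
  by_cases h : x ∈ G.piece c
  · rw [L.eq_comp x h]
    exact L.onto.bij.mapsTo (L.apply_mem F h).2
  · exact (L.branch x hx h).bij.mapsTo (mem_piece hx)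

theorem continuousOn (L : IsLevel f c l r E G u w H) (F : Fold f c l r E) :
    ContinuousOn G.toFun G.dom := by
  intro x hx
  refine ContinuousAt.continuousWithinAt ?_
  have hn : G.piece x ∈ 𝓝 x := (L.isOpen_piece x).mem_nhds (mem_piece hx)
  refine ContinuousOn.continuousAt (s := G.piece x) ?_ hn
  by_cases h : x ∈ G.piece c
  · rw [← piece_eq_of_mem h]
    refine ContinuousOn.congr (f := H ∘ f) ?_ fun z hz => L.eq_comp z hz
    exact L.onto.cont.comp (F.cont.mono fun z hz => (L.apply_mem F hz).1)
      fun z hz => (L.apply_mem F hz).2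
  · exact (L.branch x hx h).cont

theorem chain_onto (L : IsLevel f c l r E G u w H) {y : ℝ} {N : ℕ}
    (h : ∀ i < N, G.toFun^[i] y ∈ G.dom ∧ G.toFun^[i] y ∉ G.piece c) :
    Onto G.toFun^[N] (G.chain y N) G.target := by
  induction N with
  | zero =>
    obtain ⟨a, b, hab, e⟩ := L.isIoo_target
    rw [chain_zero, e]
    exact (Onto.id_Ioo hab).congr fun x _ => rfl
  | succ N ih =>
    obtain ⟨h1, h2⟩ := h N N.lt_succ_self
    rw [chain_succ, Function.iterate_succ']
    exact (L.branch _ h1 h2).comp ((ih fun i hi => h i (hi.trans N.lt_succ_self)).restrict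
      (L.isIoo_piece h1) ((G.piece_subset _).trans L.dom_subset))

theorem isIoo_center (L : IsLevel f c l r E G u w H) : IsIoo (G.piece c) := L.isIoo_piece L.mem_dom

theorem center_subset (L : IsLevel f c l r E G u w H) : G.piece c ⊆ G.target :=
  (G.piece_subset c).trans L.dom_subset

theorem _root_.PartialMap.IsFirst.noncentral {x : ℝ} {q : ℕ} (h : G.IsFirst (G.piece c) x q) :
    ∀ i < q - 1, G.toFun^[i] (G.toFun x) ∈ G.dom ∧ G.toFun^[i] (G.toFun x) ∉ G.piece c := by
  intro i hi
  rw [← Function.iterate_succ_apply]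
  exact ⟨h.mem_dom (by omega), h.notMem (by omega) (by omega)⟩

end IsLevel

/-- The part of the itinerary set of the image of `x` that is mapped to the central piece by the
first return. -/
def hitSet (G : PartialMap) (c x : ℝ) (q : ℕ) : Set ℝ :=
  G.chain (G.toFun x) (q - 1) ∩ G.toFun^[q - 1] ⁻¹' G.piece c

namespace IsLevel

variable {f : ℝ → ℝ} {c l r E : ℝ} {G : PartialMap} {u w : ℝ} {H : ℝ → ℝ}

theorem hitSet_onto (L : IsLevel f c l r E G u w H) {x : ℝ} {q : ℕ}
    (h : G.IsFirst (G.piece c) x q) :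
    Onto G.toFun^[q - 1] (G.hitSet c x q) (G.piece c) :=
  (L.chain_onto h.noncentral).restrict L.isIoo_center L.center_subset

theorem hitSet_subset (x : ℝ) (q : ℕ) : G.hitSet c x q ⊆ G.target := fun _ hz => hz.1.1

theorem lift_onto (L : IsLevel f c l r E G u w H) {x : ℝ} {q : ℕ}
    (h : G.IsFirst (G.piece c) x q) :
    Onto (G.toFun^[q - 1] ∘ H) (Ioo u w ∩ H ⁻¹' G.hitSet c x q) (G.piece c) :=
  (L.hitSet_onto h).comp (L.onto.restrict (L.hitSet_onto h).isIoo_left (hitSet_subset x q))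

theorem isFirst_of_mem_lift (L : IsLevel f c l r E G u w H) {x z : ℝ} {q : ℕ}
    (h : G.IsFirst (G.piece c) x q) (hz : z ∈ G.piece c)
    (hfz : f z ∈ Ioo u w ∩ H ⁻¹' G.hitSet c x q) :
    G.IsFirst (G.piece c) z q ∧ G.toFun^[q] z = (G.toFun^[q - 1] ∘ H) (f z) := by
  have hq : 1 ≤ q := h.1.1
  have hG : G.toFun z = H (f z) := L.eq_comp z hz
  have hit : G.toFun z ∈ G.hitSet c x q := by rw [hG]; exact hfz.2
  have e : G.toFun^[q] z = G.toFun^[q - 1] (G.toFun z) := by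
    rw [← Function.iterate_succ_apply]; congr 2; omega
  have hmid : ∀ i < q, 1 ≤ i → G.toFun^[i] z ∈ G.piece (G.toFun^[i] x) := by
    intro i hi h1
    obtain ⟨j, rfl⟩ : ∃ j, i = j + 1 := ⟨i - 1, by omega⟩
    rw [Function.iterate_succ_apply, Function.iterate_succ_apply]
    exact hit.1.2 j (by omega)
  refine ⟨⟨⟨hq, fun i hi => ?_, ?_⟩, fun p hp hret => ?_⟩, by rw [e, hG]; rfl⟩
  · rcases Nat.eq_zero_or_pos i with rfl | h1
    · exact G.piece_subset c hz
    · exact G.piece_subset _ (hmid i hi h1)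
  · rw [e]; exact hit.2
  · exact notMem_piece_of_mem (h.mem_dom hp) (h.notMem hp hret.1) (hmid p hp hret.1) hret.2.2

theorem mem_lift_of_preconnected (L : IsLevel f c l r E G u w H) (F : Fold f c l r E)
    {x : ℝ} {q : ℕ} (h : G.IsFirst (G.piece c) x q) {S : Set ℝ} (hS : IsPreconnected S)
    (hSsub : S ⊆ G.returnDom (G.piece c)) (hx : x ∈ S) {z : ℝ} (hz : z ∈ S) :
    f z ∈ Ioo u w ∩ H ⁻¹' G.hitSet c x q := by
  have key : ∀ i, i ≤ q → (∀ j ≤ i, ∀ z ∈ S, G.toFun^[j] z ∈ G.piece (G.toFun^[j] x)) ∧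
      ContinuousOn G.toFun^[i] S := by
    intro i
    induction i with
    | zero =>
      refine fun _ => ⟨fun j hj z hz => ?_, continuousOn_id⟩
      obtain rfl : j = 0 := by omega
      have hxP := (hSsub hx).1
      simp only [Function.iterate_zero, id]
      rw [← piece_eq_of_mem hxP]
      exact (hSsub hz).1
    | succ i ih =>
      intro hi
      obtain ⟨ih1, ih2⟩ := ih (by omega)
      have hc : ContinuousOn G.toFun^[i + 1] S := by
        rw [Function.iterate_succ']
        exact (L.continuousOn F).comp ih2 fun z hz => G.piece_subset _ (ih1 i le_rfl z hz)
      have hd : G.toFun^[i + 1] '' S ⊆ G.dom := by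
        rintro _ ⟨z, hz, rfl⟩
        obtain ⟨-, p, hp⟩ := mem_returnDom_iff.1 (hSsub hz)
        rcases lt_trichotomy p (i + 1) with hlt | rfl | hgt
        · exact absurd hp.1.2.2 (notMem_piece_of_mem (h.mem_dom (by omega))
            (h.notMem (by omega) hp.1.1) (ih1 p (by omega) z hz))
        · exact G.piece_subset c hp.1.2.2
        · exact hp.mem_dom hgt
      refine ⟨fun j hj z hz => ?_, hc⟩
      rcases Nat.lt_succ_iff_lt_or_eq.1 (Nat.lt_succ_of_le hj) with hj | rfl
      · exact ih1 j (by omega) z hz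
      · exact (hS.image _ hc).subset_connectedComponentIn ⟨x, hx, rfl⟩ hd ⟨z, hz, rfl⟩
  obtain ⟨k, -⟩ := key q le_rfl
  have hzP := (hSsub hz).1
  refine ⟨(L.apply_mem F hzP).2, ?_⟩
  rw [mem_preimage, ← L.eq_comp z hzP]
  refine ⟨⟨L.mapsTo F (G.piece_subset c hzP), fun i hi => ?_⟩, ?_⟩
  · have := k (i + 1) (by omega) z hz
    rwa [Function.iterate_succ_apply, Function.iterate_succ_apply] at this
  · have := k q le_rfl z hz
    rw [← piece_eq_of_mem h.1.2.2] at this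
    obtain ⟨j, rfl⟩ : ∃ j, q = j + 1 := ⟨q - 1, by have := h.1.1; omega⟩
    exact this

/-- The components of the domain of the first return map to the central piece. -/
theorem component_cases (L : IsLevel f c l r E G u w H) (F : Fold f c l r E)
    {x : ℝ} {q : ℕ} (hx : x ∈ G.piece c) (h : G.IsFirst (G.piece c) x q) :
    ∃ m₁ m₂, m₁ < m₂ ∧ u ≤ m₁ ∧ m₂ ≤ w ∧ Ioo u w ∩ H ⁻¹' G.hitSet c x q = Ioo m₁ m₂ ∧
      ((f c ∈ Ioo m₁ m₂ ∧ connectedComponentIn (G.returnDom (G.piece c)) x =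
          {z ∈ Ioo l r | f z < m₂}) ∨
        (f c ≤ m₁ ∧ connectedComponentIn (G.returnDom (G.piece c)) x =
          Ioo c r ∩ f ⁻¹' Ioo m₁ m₂) ∨
        (f c ≤ m₁ ∧ connectedComponentIn (G.returnDom (G.piece c)) x =
          Ioo l c ∩ f ⁻¹' Ioo m₁ m₂)) := by
  obtain ⟨m₁, m₂, hm, hU⟩ := (L.lift_onto h).isIoo_left
  have hxR : x ∈ G.returnDom (G.piece c) := mem_returnDom_iff.2 ⟨hx, q, h⟩
  set C := connectedComponentIn (G.returnDom (G.piece c)) x with hC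
  have hCsub : C ⊆ G.returnDom (G.piece c) := connectedComponentIn_subset _ _
  have hxC : x ∈ C := mem_connectedComponentIn hxR
  have hCpre : IsPreconnected C := isPreconnected_connectedComponentIn
  have hCU : ∀ z ∈ C, f z ∈ Ioo m₁ m₂ := fun z hz => by
    rw [← hU]; exact L.mem_lift_of_preconnected F h hCpre hCsub hxC hz
  have hCI : ∀ z ∈ C, z ∈ Ioo l r := fun z hz => (L.apply_mem F (hCsub hz).1).1
  obtain ⟨hum, hmw⟩ := (Ioo_subset_Ioo_iff hm).1 (hU ▸ inter_subset_left : Ioo m₁ m₂ ⊆ Ioo u w)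
  have hret : ∀ z ∈ Ioo l r, f z ∈ Ioo m₁ m₂ → z ∈ G.returnDom (G.piece c) := by
    intro z hz hfz
    have hzP : z ∈ G.piece c := by rw [L.piece_eq]; exact ⟨hz, hfz.2.trans_le hmw⟩
    exact mem_returnDom_iff.2 ⟨hzP, q, (L.isFirst_of_mem_lift h hzP (hU ▸ hfz)).1⟩
  refine ⟨m₁, m₂, hm, hum, hmw, hU, ?_⟩
  by_cases hc : f c ∈ Ioo m₁ m₂
  · refine Or.inl ⟨hc, Subset.antisymm (fun z hz => ⟨hCI z hz, (hCU z hz).2⟩) ?_⟩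
    refine (F.isIoo_sublevel hc.2 (hmw.trans L.w_le)).isPreconnected.subset_connectedComponentIn
      ⟨hCI x hxC, (hCU x hxC).2⟩ fun z hz => ?_
    exact hret z hz.1 ⟨hc.1.trans_le (F.min_le hz.1), hz.2⟩
  · refine Or.inr ?_
    have hxI := hCI x hxC
    have hfx := hCU x hxC
    have hcm : f c ≤ m₁ := not_lt.1 fun hlt => hc ⟨hlt, (F.min_le hxI).trans_lt hfx.2⟩
    have hcC : c ∉ C := fun hcC => hc (hCU c hcC)
    have hsub : Ioo m₁ m₂ ⊆ Ioo (f c) E := Ioo_subset_Ioo hcm (hmw.trans L.w_le)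
    have hMI : IsIoo (Ioo m₁ m₂) := ⟨_, _, hm, rfl⟩
    rcases lt_trichotomy x c with hlt | rfl | hgt
    · refine Or.inr ⟨hcm, Subset.antisymm (fun z hz => ⟨⟨(hCI z hz).1, ?_⟩, hCU z hz⟩) ?_⟩
      · by_contra hzc
        exact hcC (hCpre.ordConnected.out hxC hz ⟨hlt.le, not_lt.1 hzc⟩)
      · exact (F.onto_left.restrict hMI hsub).isIoo_left.isPreconnected.subset_connectedComponentIn
          ⟨⟨hxI.1, hlt⟩, hfx⟩ fun z hz => hret z ⟨hz.1.1, hz.1.2.trans F.cr⟩ hz.2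
    · exact absurd hxC hcC
    · refine Or.inl ⟨hcm, Subset.antisymm (fun z hz => ⟨⟨?_, (hCI z hz).2⟩, hCU z hz⟩) ?_⟩
      · by_contra hzc
        exact hcC (hCpre.ordConnected.out hz hxC ⟨not_lt.1 hzc, hgt.le⟩)
      · exact (F.onto_right.restrict hMI hsub).isIoo_left.isPreconnected.subset_connectedComponentIn
          ⟨⟨hgt, hxI.2⟩, hfx⟩ fun z hz => hret z ⟨F.lc.trans hz.1.1, hz.1.2⟩ hz.2

theorem preRenorm_apply {x : ℝ} {q : ℕ} (h : G.IsFirst (G.piece c) x q) :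
    (G.preRenorm c).toFun x = G.toFun^[q] x := by
  simp only [preRenorm, h.returnTime_eq, ENat.toNat_natCast]

theorem exists_isFirst_orbit (L : IsLevel f c l r E G u w H) {m : ℕ}
    (hm : G.toFun^[m] c ∈ G.piece c) :
    G.toFun^[m] c ∈ (G.preRenorm c).dom ∧
      ∀ k, 1 ≤ k → G.toFun^[m + k] c ∈ G.piece c →
        ∃ q, 1 ≤ q ∧ q ≤ k ∧ (G.preRenorm c).toFun (G.toFun^[m] c) = G.toFun^[m + q] c ∧
          G.toFun^[m + q] c ∈ G.piece c := by
  have hnhds : G.piece c ∈ 𝓝 c := (L.isOpen_piece c).mem_nhds (mem_piece L.mem_dom)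
  have hret : ∀ k, 1 ≤ k → G.toFun^[m + k] c ∈ G.piece c →
      G.IsReturn (G.piece c) (G.toFun^[m] c) k := by
    intro k hk hmk
    refine ⟨hk, fun i _ => ?_, ?_⟩
    · rw [← Function.iterate_add_apply]; exact L.isRecurrent.1 _
    · rw [← Function.iterate_add_apply, add_comm]; exact hmk
  constructor
  · obtain ⟨n, hn, hnP⟩ := frequently_atTop.1
      (mapClusterPt_iff_frequently.1 L.isRecurrent.2 _ hnhds) (m + 1)
    have hR : G.toFun^[m] c ∈ G.returnDom (G.piece c) :=
      ⟨hm, n - m, hret _ (by omega) (by rwa [Nat.add_sub_cancel' (by omega)])⟩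
    exact ⟨hR, m, mem_connectedComponentIn hR⟩
  · intro k hk hmk
    obtain ⟨q, hq, hfirst⟩ := (hret k hk hmk).exists_isFirst
    have e : G.toFun^[q] (G.toFun^[m] c) = G.toFun^[m + q] c := by
      rw [← Function.iterate_add_apply, add_comm]
    exact ⟨q, hfirst.1.1, hq, by rw [preRenorm_apply hfirst, e], e ▸ hfirst.1.2.2⟩

theorem isRecurrent_preRenorm (L : IsLevel f c l r E G u w H) :
    (G.preRenorm c).IsRecurrent c := by
  have hnhds : G.piece c ∈ 𝓝 c := (L.isOpen_piece c).mem_nhds (mem_piece L.mem_dom)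
  have hfreq := mapClusterPt_iff_frequently.1 L.isRecurrent.2
  have h1 : ∀ i, ∃ m, (G.preRenorm c).toFun^[i] c = G.toFun^[m] c ∧ G.toFun^[m] c ∈ G.piece c := by
    intro i
    induction i with
    | zero => exact ⟨0, rfl, mem_piece L.mem_dom⟩
    | succ i ih =>
      obtain ⟨m, e, hm⟩ := ih
      obtain ⟨n, hn, hnP⟩ := frequently_atTop.1 (hfreq _ hnhds) (m + 1)
      obtain ⟨q, -, -, e', hq⟩ := (L.exists_isFirst_orbit hm).2 (n - m) (by omega)
        (by rwa [Nat.add_sub_cancel' (by omega)])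
      exact ⟨m + q, by rw [Function.iterate_succ_apply', e, e'], hq⟩
  have h2 : ∀ k m, G.toFun^[m] c ∈ G.piece c → G.toFun^[m + k] c ∈ G.piece c →
      ∃ j, (G.preRenorm c).toFun^[j] (G.toFun^[m] c) = G.toFun^[m + k] c := by
    intro k
    induction k using Nat.strong_induction_on with
    | _ k ih =>
      intro m hm hk
      rcases Nat.eq_zero_or_pos k with rfl | hk0
      · exact ⟨0, rfl⟩
      obtain ⟨q, hq1, hqk, e, hq⟩ := (L.exists_isFirst_orbit hm).2 k hk0 hk
      obtain ⟨j, hj⟩ := ih (k - q) (by omega) (m + q) hq (by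
        rwa [show m + q + (k - q) = m + k by omega])
      refine ⟨j + 1, ?_⟩
      rw [Function.iterate_succ_apply, e, hj, show m + q + (k - q) = m + k by omega]
  refine ⟨fun i => ?_, mapClusterPt_iff_frequently.2 fun s hs => frequently_atTop.2 fun i => ?_⟩
  · obtain ⟨m, e, hm⟩ := h1 i
    rw [e]; exact (L.exists_isFirst_orbit hm).1
  · obtain ⟨m, e, hm⟩ := h1 i
    obtain ⟨n, hn, hns⟩ := frequently_atTop.1 (hfreq _ (inter_mem hs hnhds)) m
    obtain ⟨j, hj⟩ := h2 (n - m) m hm (by rw [Nat.add_sub_cancel' hn]; exact hns.2)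
    refine ⟨i + j, by omega, ?_⟩
    rw [add_comm, Function.iterate_add_apply, e, hj, Nat.add_sub_cancel' hn]
    exact hns.1

/-- One step of generalized renormalization. -/
theorem preRenorm (L : IsLevel f c l r E G u w H) (F : Fold f c l r E)
    (hnc : G.toFun c ∉ G.piece c) :
    ∃ u' w' û ŵ H', IsLevel f c l r E (G.preRenorm c) u' w' H' ∧ û ≤ u' ∧ w' ≤ ŵ ∧ ŵ ≤ w ∧
      û < f c ∧ f c < ŵ ∧ Ioo û ŵ ⊆ Ioo u w ∧ Onto H' (Ioo û ŵ) G.target ∧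
      ∀ z ∈ Ioo û ŵ, H z ∉ G.piece c := by
  have hrec := L.isRecurrent_preRenorm
  have hdom : ∀ {x}, x ∈ (G.preRenorm c).dom → x ∈ G.piece c ∧
      ∃ q, G.IsFirst (G.piece c) x q := fun hx => mem_returnDom_iff.1 hx.1
  obtain ⟨hcP, q, hq⟩ := hdom (hrec.1 0)
  simp only [Function.iterate_zero, id] at hcP hq
  have hc' : c ∈ (G.preRenorm c).dom := hrec.1 0
  obtain ⟨u', w', huw', -, -, hU, hcases⟩ := L.component_cases F hcP hq
  have hcU : f c ∈ Ioo u' w' := by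
    rw [← hU]
    exact L.mem_lift_of_preconnected F hq isPreconnected_connectedComponentIn
      (connectedComponentIn_subset _ _) (mem_connectedComponentIn hc'.1)
      (mem_connectedComponentIn hc'.1)
  have hpiece : (G.preRenorm c).piece c = {z ∈ Ioo l r | f z < w'} := by
    rw [preRenorm_piece hc']
    rcases hcases with h | h | h
    · exact h.2
    · exact absurd hcU.1 (not_lt.2 h.1)
    · exact absurd hcU.1 (not_lt.2 h.1)
  have hch := L.chain_onto hq.noncentral
  have hext := L.onto.restrict hch.isIoo_left (fun z hz => hz.1)
  obtain ⟨û, ŵ, huw, hÛ⟩ := hext.isIoo_left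
  have hsub1 : Ioo u' w' ⊆ Ioo û ŵ := by
    rw [← hU, ← hÛ]; exact fun z hz => ⟨hz.1, hz.2.1⟩
  have hsub2 : Ioo û ŵ ⊆ Ioo u w := by rw [← hÛ]; exact inter_subset_left
  obtain ⟨i1, i2⟩ := (Ioo_subset_Ioo_iff huw').1 hsub1
  obtain ⟨i3, i4⟩ := (Ioo_subset_Ioo_iff huw).1 hsub2
  have hLU : Onto (G.toFun^[q - 1] ∘ H) (Ioo u' w') (G.piece c) := by
    rw [← hU]; exact L.lift_onto hq
  refine ⟨u', w', û, ŵ, G.toFun^[q - 1] ∘ H, ?_, i1, i2, i4, i1.trans_lt hcU.1, hcU.2.trans_le i2,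
    hsub2, ?_, ?_⟩
  · refine ⟨L.isIoo_center, ?_, fun x hx => (hdom hx).1, ?_, hcU.1, hcU.2,
      i2.trans (i4.trans L.w_le), hLU, hpiece, ?_, hrec⟩
    · rw [isOpen_iff_mem_nhds]
      intro x hx
      refine mem_of_superset ?_ (piece_subset (G.preRenorm c) x)
      rw [preRenorm_piece hx]
      refine IsOpen.mem_nhds ?_ (mem_connectedComponentIn hx.1)
      obtain ⟨hxP, p, hp⟩ := hdom hx
      obtain ⟨m₁, m₂, hm, -, hmw, -, h⟩ := L.component_cases F hxP hp
      have hMI : IsIoo (Ioo m₁ m₂) := ⟨_, _, hm, rfl⟩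
      rcases h with ⟨h1, h2⟩ | ⟨h1, h2⟩ | ⟨h1, h2⟩
      · rw [h2]; exact (F.isIoo_sublevel h1.2 (hmw.trans L.w_le)).isOpen
      · rw [h2]; exact (F.onto_right.restrict hMI
          (Ioo_subset_Ioo h1 (hmw.trans L.w_le))).isIoo_left.isOpen
      · rw [h2]; exact (F.onto_left.restrict hMI
          (Ioo_subset_Ioo h1 (hmw.trans L.w_le))).isIoo_left.isOpen
    · intro x hx hxc
      obtain ⟨hxP, p, hp⟩ := hdom hx
      obtain ⟨m₁, m₂, hm, -, hmw, hU, h⟩ := L.component_cases F hxP hp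
      have hMI : IsIoo (Ioo m₁ m₂) := ⟨_, _, hm, rfl⟩
      rw [← preRenorm_piece hx] at h
      have hLM : Onto (G.toFun^[p - 1] ∘ H) (Ioo m₁ m₂) (G.piece c) := by
        rw [← hU]; exact L.lift_onto hp
      have hfun : ∀ z ∈ Ioo l r, f z ∈ Ioo m₁ m₂ →
          (G.preRenorm c).toFun z = ((G.toFun^[p - 1] ∘ H) ∘ f) z := by
        intro z hz hfz
        have hzP : z ∈ G.piece c := by rw [L.piece_eq]; exact ⟨hz, hfz.2.trans_le hmw⟩
        obtain ⟨h1, h2⟩ := L.isFirst_of_mem_lift hp hzP (hU ▸ hfz)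
        rw [preRenorm_apply h1, h2]; rfl
      rcases h with ⟨h1, h2⟩ | ⟨h1, h2⟩ | ⟨h1, h2⟩
      · refine absurd (mem_piece hx) ?_
        have : c ∈ (G.preRenorm c).piece x := by rw [h2]; exact ⟨F.mem_c, h1.2⟩
        rwa [piece_eq_of_mem this]
      · rw [h2]
        exact (hLM.comp (F.onto_right.restrict hMI
          (Ioo_subset_Ioo h1 (hmw.trans L.w_le)))).congr fun z hz =>
            hfun z ⟨F.lc.trans hz.1.1, hz.1.2⟩ hz.2
      · rw [h2]
        exact (hLM.comp (F.onto_left.restrict hMI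
          (Ioo_subset_Ioo h1 (hmw.trans L.w_le)))).congr fun z hz =>
            hfun z ⟨hz.1.1, hz.1.2.trans F.cr⟩ hz.2
    · intro z hz
      rw [hpiece] at hz
      have hzP : z ∈ G.piece c := by
        rw [L.piece_eq]; exact ⟨hz.1, hz.2.trans_le (i2.trans i4)⟩
      obtain ⟨h1, h2⟩ := L.isFirst_of_mem_lift hq hzP
        (by rw [hU]; exact ⟨hcU.1.trans_le (F.min_le hz.1), hz.2⟩)
      rw [preRenorm_apply h1, h2]
  · rw [← hÛ]; exact hch.comp hext
  · intro z hz
    rw [← hÛ] at hz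
    have hq2 : 0 < q - 1 := by
      have h1 := hq.1.1
      rcases Nat.lt_or_ge 1 q with h | h
      · omega
      · obtain rfl : q = 1 := by omega
        exact absurd hq.1.2.2 hnc
    obtain ⟨h1, h2⟩ := hq.noncentral 0 hq2
    exact notMem_piece_of_mem h1 h2 (hz.2.2 0 hq2)

end IsLevel
end PartialMap

/-- A `C³` unimodal map with negative Schwarzian derivative and a nondegenerate minimum is a
fold. -/
theorem Fold.of_contDiffOn {f : ℝ → ℝ} {c l r E : ℝ} (hc : c ∈ Ioo l r)
    (hf : ContDiffOn ℝ 3 f (Ioo l r)) (hcrit : ∀ x ∈ Ioo l r, deriv f x = 0 ↔ x = c)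
    (hpos : 0 < iteratedDeriv 2 f c) (hS : ∀ x ∈ Ioo l r, x ≠ c → schwarzian f x < 0)
    (hl : Tendsto f (𝓝[>] l) (𝓝 E)) (hr : Tendsto f (𝓝[<] r) (𝓝 E)) : Fold f c l r E := by
  have ho : IsOpen (Ioo l r) := isOpen_Ioo
  have hf1 : ContDiffOn ℝ 2 (deriv f) (Ioo l r) :=
    ((contDiffOn_succ_iff_deriv_of_isOpen ho).1 (hf : ContDiffOn ℝ (2 + 1) f _)).2.2
  have d0 : ∀ x ∈ Ioo l r, HasDerivAt f (deriv f x) x := fun x hx =>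
    ((hf.differentiableOn (by norm_num)).differentiableAt (ho.mem_nhds hx)).hasDerivAt
  have d1 : DifferentiableAt ℝ (deriv f) c :=
    (hf1.differentiableOn (by norm_num)).differentiableAt (ho.mem_nhds hc)
  have hk : ContinuousOn (dslope (deriv f) c) (Ioo l r) :=
    (continuousOn_dslope (ho.mem_nhds hc)).2 ⟨hf1.continuousOn, d1⟩
  have hd : ∀ x, deriv f x = (x - c) * dslope (deriv f) c x := by
    intro x
    have h1 := sub_smul_dslope (deriv f) c x
    rw [(hcrit c hc).2 rfl, sub_zero, smul_eq_mul] at h1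
    exact h1.symm
  have hkc : 0 < dslope (deriv f) c c := by
    rw [dslope_same]
    rwa [iteratedDeriv_succ, iteratedDeriv_one] at hpos
  have hk0 : ∀ x ∈ Ioo l r, dslope (deriv f) c x ≠ 0 := by
    intro x hx h0
    have h1 : deriv f x = 0 := by rw [hd, h0, mul_zero]
    rw [(hcrit x hx).1 h1] at h0
    exact hkc.ne' h0
  have hkpos : ∀ x ∈ Ioo l r, 0 < dslope (deriv f) c x := by
    intro x hx
    by_contra hcon
    obtain ⟨y, hy, hy0⟩ := isPreconnected_Ioo.intermediate_value hx hc hk ⟨not_lt.1 hcon, hkc.le⟩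
    exact hk0 y hy hy0
  have hsubR : Ioo c r ⊆ Ioo l r := Ioo_subset_Ioo_left hc.1.le
  have hsubL : Ioo l c ⊆ Ioo l r := Ioo_subset_Ioo_right hc.2.le
  refine ⟨hc.1, hc.2, hf.continuousOn, ?_, ?_, hl, hr, ?_, ?_, ?_⟩
  · refine strictAntiOn_of_hasDerivWithinAt_neg (f' := deriv f) (convex_Ioc l c)
      (hf.continuousOn.mono fun x hx => ⟨hx.1, hx.2.trans_lt hc.2⟩) ?_ ?_ <;>
      rw [interior_Ioc] <;> intro x hx
    · exact (d0 x (hsubL hx)).hasDerivWithinAt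
    · rw [hd]; exact mul_neg_of_neg_of_pos (by linarith [hx.2]) (hkpos x (hsubL hx))
  · refine strictMonoOn_of_hasDerivWithinAt_pos (f' := deriv f) (convex_Ico c r)
      (hf.continuousOn.mono fun x hx => ⟨hc.1.trans_le hx.1, hx.2⟩) ?_ ?_ <;>
      rw [interior_Ico] <;> intro x hx
    · exact (d0 x (hsubR hx)).hasDerivWithinAt
    · rw [hd]; exact mul_pos (by linarith [hx.1]) (hkpos x (hsubR hx))
  · exact CrossExp.of_schwarzian_neg isOpen_Ioo (convex_Ioo _ _) (hf.mono hsubL)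
      (fun x hx => mt (hcrit x (hsubL hx)).1 hx.2.ne) fun x hx => hS x (hsubL hx) hx.2.ne
  · exact CrossExp.of_schwarzian_neg isOpen_Ioo (convex_Ioo _ _) (hf.mono hsubR)
      (fun x hx => mt (hcrit x (hsubR hx)).1 hx.1.ne') fun x hx => hS x (hsubR hx) hx.1.ne'
  · intro p q hlp hpc hcq hqr
    have hsub : Icc p q ⊆ Ioo l r := fun x hx => ⟨hlp.trans_le hx.1, hx.2.trans_lt hqr⟩
    have hne : (Icc p q).Nonempty := ⟨c, hpc.le, hcq.le⟩
    obtain ⟨x₁, hx₁, hmin⟩ := isCompact_Icc.exists_isMinOn hne (hk.mono hsub)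
    obtain ⟨x₂, hx₂, hmax⟩ := isCompact_Icc.exists_isMaxOn hne (hk.mono hsub)
    have hmin' : ∀ x ∈ Icc p q, dslope (deriv f) c x₁ ≤ dslope (deriv f) c x :=
      fun x hx => hmin hx
    have hmax' : ∀ x ∈ Icc p q, dslope (deriv f) c x ≤ dslope (deriv f) c x₂ :=
      fun x hx => hmax hx
    set A := dslope (deriv f) c x₁ / 2 with hA
    set B := dslope (deriv f) c x₂ / 2 with hB
    have hp1 := hkpos x₁ (hsub hx₁)
    have h12 := hmin' x₂ hx₂
    have D : ∀ K : ℝ, ∀ x ∈ Ioo l r, HasDerivAt (fun y => f y - K * (y - c) ^ 2)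
        ((x - c) * (dslope (deriv f) c x - 2 * K)) x := by
      intro K x hx
      have h1 := (((hasDerivAt_id' x).sub_const c).pow 2).const_mul K
      have h2 := (d0 x hx).sub h1
      have e : deriv f x - K * ((2 : ℕ) * (x - c) ^ (2 - 1) * 1) =
          (x - c) * (dslope (deriv f) c x - 2 * K) := by rw [hd]; push_cast; ring
      rw [← e]; exact h2
    have R : ∀ K : ℝ, (∀ x ∈ Icc c q, 0 ≤ dslope (deriv f) c x - 2 * K) →
        MonotoneOn (fun y => f y - K * (y - c) ^ 2) (Icc c q) := fun K hK =>
      monotoneOn_of_hasDerivWithinAt_nonneg (convex_Icc c q)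
        (fun x hx => (D K x (hsub ⟨hpc.le.trans hx.1, hx.2⟩)).continuousAt.continuousWithinAt)
        (fun x hx => (D K x (hsub ⟨hpc.le.trans (interior_subset hx).1,
          (interior_subset hx).2⟩)).hasDerivWithinAt)
        (fun x hx => mul_nonneg (sub_nonneg.2 (interior_subset hx).1) (hK x (interior_subset hx)))
    have R' : ∀ K : ℝ, (∀ x ∈ Icc c q, dslope (deriv f) c x - 2 * K ≤ 0) →
        AntitoneOn (fun y => f y - K * (y - c) ^ 2) (Icc c q) := fun K hK =>
      antitoneOn_of_hasDerivWithinAt_nonpos (convex_Icc c q)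
        (fun x hx => (D K x (hsub ⟨hpc.le.trans hx.1, hx.2⟩)).continuousAt.continuousWithinAt)
        (fun x hx => (D K x (hsub ⟨hpc.le.trans (interior_subset hx).1,
          (interior_subset hx).2⟩)).hasDerivWithinAt)
        (fun x hx => mul_nonpos_of_nonneg_of_nonpos (sub_nonneg.2 (interior_subset hx).1)
          (hK x (interior_subset hx)))
    have S : ∀ K : ℝ, (∀ x ∈ Icc p c, 0 ≤ dslope (deriv f) c x - 2 * K) →
        AntitoneOn (fun y => f y - K * (y - c) ^ 2) (Icc p c) := fun K hK =>
      antitoneOn_of_hasDerivWithinAt_nonpos (convex_Icc p c)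
        (fun x hx => (D K x (hsub ⟨hx.1, hx.2.trans hcq.le⟩)).continuousAt.continuousWithinAt)
        (fun x hx => (D K x (hsub ⟨(interior_subset hx).1,
          (interior_subset hx).2.trans hcq.le⟩)).hasDerivWithinAt)
        (fun x hx => mul_nonpos_of_nonpos_of_nonneg (sub_nonpos.2 (interior_subset hx).2)
          (hK x (interior_subset hx)))
    have S' : ∀ K : ℝ, (∀ x ∈ Icc p c, dslope (deriv f) c x - 2 * K ≤ 0) →
        MonotoneOn (fun y => f y - K * (y - c) ^ 2) (Icc p c) := fun K hK =>
      monotoneOn_of_hasDerivWithinAt_nonneg (convex_Icc p c)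
        (fun x hx => (D K x (hsub ⟨hx.1, hx.2.trans hcq.le⟩)).continuousAt.continuousWithinAt)
        (fun x hx => (D K x (hsub ⟨(interior_subset hx).1,
          (interior_subset hx).2.trans hcq.le⟩)).hasDerivWithinAt)
        (fun x hx => mul_nonneg_of_nonpos_of_nonpos (sub_nonpos.2 (interior_subset hx).2)
          (hK x (interior_subset hx)))
    refine ⟨A, B, by positivity, by rw [hA, hB]; linarith, ?_, ?_⟩
    · intro x y h1 h2 h3
      have m1 : x ∈ Icc c q := ⟨h1, h2.trans h3⟩
      have m2 : y ∈ Icc c q := ⟨h1.trans h2, h3⟩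
      have i1 := R A (fun z hz => by
        have := hmin' z ⟨hpc.le.trans hz.1, hz.2⟩; rw [hA]; linarith) m1 m2 h2
      have i2 := R' B (fun z hz => by
        have := hmax' z ⟨hpc.le.trans hz.1, hz.2⟩; rw [hB]; linarith) m1 m2 h2
      simp only at i1 i2
      exact ⟨by linarith, by linarith⟩
    · intro x y h1 h2 h3
      have m1 : x ∈ Icc p c := ⟨h1.trans h2, h3⟩
      have m2 : y ∈ Icc p c := ⟨h1, h2.trans h3⟩
      have i1 := S A (fun z hz => by
        have := hmin' z ⟨hz.1, hz.2.trans hcq.le⟩; rw [hA]; linarith) m2 m1 h2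
      have i2 := S' B (fun z hz => by
        have := hmax' z ⟨hz.1, hz.2.trans hcq.le⟩; rw [hB]; linarith) m2 m1 h2
      simp only at i1 i2
      exact ⟨by linarith, by linarith⟩

namespace PartialMap

/-- A map of class `𝒯` with recurrent critical point is a level map of its own fold. -/
theorem ClassT.exists_isLevel {g : PartialMap} {c : ℝ} (hg : g.ClassT c) (hrec : g.IsRecurrent c) :
    ∃ f l r E u w H, Fold f c l r E ∧ IsLevel f c l r E g u w H := by
  obtain ⟨a, b, l, r, e, hab, htar, hlr, hP, he, htl, htr⟩ := hg.central
  have hcP : c ∈ Ioo l r := by rw [← hP]; exact mem_piece hg.mem_dom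
  have hsub : Ioo l r ⊆ g.dom := by rw [← hP]; exact g.piece_subset c
  have hf := hg.contDiffOn.mono hsub
  have hTI : IsIoo g.target := ⟨a, b, hab, htar⟩
  have hgc : g.toFun c ∈ Ioo a b := by rw [← htar]; exact hg.mapsTo hg.mem_dom
  have hbranch : ∀ x ∈ g.dom, x ∉ g.piece c → Onto g.toFun (g.piece x) g.target := by
    intro x hx hxc
    have hne : g.piece x ≠ g.piece c := fun h => hxc (h ▸ mem_piece hx)
    have hopen : IsOpen (g.piece x) := hg.isOpen_dom.connectedComponentIn
    have hpre : IsPreconnected (g.piece x) := isPreconnected_connectedComponentIn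
    have hcx : ∀ y ∈ g.piece x, y ≠ c := fun y hy h => by
      rw [h] at hy
      exact hne (piece_eq_of_mem hy)
    have hps := g.piece_subset x
    refine ⟨IsIoo.of_isOpen hopen hpre ⟨x, mem_piece hx⟩ (htar ▸ hps.trans hg.dom_subset), hTI,
      (hg.contDiffOn.mono hps).continuousOn, hg.branch x hx hne, ?_⟩
    exact CrossExp.of_schwarzian_neg hopen hpre.ordConnected.convex (hg.contDiffOn.mono hps)
      (fun y hy => mt (hg.deriv_eq_zero_iff y (hps hy)).1 (hcx y hy))
      fun y hy => hg.schwarzian_neg y (hps hy) (hcx y hy)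
  rcases lt_or_gt_of_ne hg.nondegenerate with h2 | h2
  · have F : Fold (fun x => - g.toFun x) c l r (-e) := by
      refine Fold.of_contDiffOn hcP hf.neg (fun x hx => ?_) ?_ (fun x hx hxc => ?_) htl.neg htr.neg
      · rw [deriv.fun_neg, neg_eq_zero]; exact hg.deriv_eq_zero_iff x (hsub hx)
      · rw [iteratedDeriv_succ, iteratedDeriv_one] at h2 ⊢
        simp only [deriv.fun_neg']
        linarith
      · rw [schwarzian_neg_fun]; exact hg.schwarzian_neg x (hsub hx) hxc
    have hea : e = a := by
      have := F.lt_limit hcP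
      rcases he with rfl | rfl
      · rfl
      · linarith [hgc.2]
    subst hea
    refine ⟨_, l, r, _, -b, -e, fun x => -x, F, hTI, hg.isOpen_dom, hg.dom_subset, hbranch,
      by linarith [hgc.2], by linarith [hgc.1], le_rfl, ?_, ?_, fun x _ => (neg_neg _).symm, hrec⟩
    · rw [htar]
      simpa using (Onto.id_Ioo (a := -b) (b := -e) (by linarith)).neg
    · rw [hP, F.sublevel_limit]
  · have F : Fold g.toFun c l r e :=
      Fold.of_contDiffOn hcP hf (fun x hx => hg.deriv_eq_zero_iff x (hsub hx)) h2
        (fun x hx hxc => hg.schwarzian_neg x (hsub hx) hxc) htl htr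
    have hea : e = b := by
      have := F.lt_limit hcP
      rcases he with rfl | rfl
      · linarith [hgc.1]
      · rfl
    subst hea
    refine ⟨_, l, r, _, a, e, fun x => x, F, hTI, hg.isOpen_dom, hg.dom_subset, hbranch,
      hgc.1, hgc.2, le_rfl, ?_, ?_, fun x _ => rfl, hrec⟩
    · rw [htar]; exact Onto.id_Ioo hab
    · rw [hP, F.sublevel_limit]

end PartialMap

/-- `N` times the length of `M` is at most `κ` times the length of each component of `T \ M`. -/
def NestedSpace (N : ℕ) (κ : ℝ) (M T : Set ℝ) : Prop := ∃ t₁ m₁ m₂ t₂ : ℝ, M = Ioo m₁ m₂ ∧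
  T = Ioo t₁ t₂ ∧ m₁ < m₂ ∧ N * (m₂ - m₁) ≤ κ * (m₁ - t₁) ∧ N * (m₂ - m₁) ≤ κ * (t₂ - m₂)

theorem NestedSpace.zero {κ : ℝ} {T : Set ℝ} (hT : IsIoo T) : NestedSpace 0 κ T T := by
  obtain ⟨a, b, hab, rfl⟩ := hT
  exact ⟨a, a, b, b, rfl, rfl, hab, by simp, by simp⟩

theorem NestedSpace.step {N : ℕ} {κ : ℝ} {K M T : Set ℝ} (hκ : 0 < κ) (h : NestedSpace N κ M T)
    (hK : Space κ K M) : NestedSpace (N + 1) κ K T := by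
  obtain ⟨t₁, m₁, m₂, t₂, rfl, rfl, hm, h1, h2⟩ := h
  obtain ⟨s₁, k₁, k₂, s₂, rfl, e, hk, h3, h4⟩ := hK
  obtain ⟨rfl, rfl⟩ := Ioo_endpoints_eq hm e
  have h3' : 0 < k₁ - m₁ := by by_contra hc; nlinarith
  have h4' : 0 < m₂ - k₂ := by by_contra hc; nlinarith
  have hN : (N : ℝ) * (k₂ - k₁) ≤ N * (m₂ - m₁) := by gcongr <;> linarith
  refine ⟨t₁, k₁, k₂, t₂, rfl, rfl, hk, ?_, ?_⟩ <;> push_cast <;> linarith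

theorem NestedSpace.space {N : ℕ} {κ : ℝ} {M T : Set ℝ} (hN : 0 < N) (h : NestedSpace N κ M T) :
    Space (κ / N) M T := by
  obtain ⟨t₁, m₁, m₂, t₂, rfl, rfl, hm, h1, h2⟩ := h
  have : (0 : ℝ) < N := by exact_mod_cast hN
  refine ⟨t₁, m₁, m₂, t₂, rfl, rfl, hm, ?_, ?_⟩
  · rw [div_mul_eq_mul_div, le_div_iff₀ this]; linarith
  · rw [div_mul_eq_mul_div, le_div_iff₀ this]; linarith

namespace PartialMap.IsLevel

variable {f : ℝ → ℝ} {c l r E : ℝ} {G : PartialMap} {u w : ℝ} {H : ℝ → ℝ}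

/-- Space around the image of a piece of the first return map gives space around the piece. -/
theorem space_piece (L : IsLevel f c l r E G u w H) (F : Fold f c l r E) {p q A B ε x : ℝ} {n : ℕ}
    (hA : 0 < A) (hAB : A ≤ B) (hε : 0 < ε) (Q : QuadBounds f c p q A B) (hlp : l < p) (hqr : q < r)
    (hpc : p < c) (hcq : c < q) (hP : G.piece c = Ioo p q) (hp : f p = w) (hq : f q = w)
    (hx : x ∈ (G.preRenorm c).dom) (hn : G.IsFirst (G.piece c) x n)
    (h : Space ε (G.hitSet c x n) G.target) :
    Space (foldLoss (B / A) (2 * ε + ε ^ 2)) ((G.preRenorm c).piece x) (G.piece c) := by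
  have h1 := L.onto.space_preimage hε h
  obtain ⟨m₁, m₂, hm, -, -, hU, hcases⟩ := L.component_cases F hx.1.1 hn
  rw [hU] at h1
  have huw : u < w := L.u_lt.trans L.lt_w
  have hε' : 0 < 2 * ε + ε ^ 2 := by positivity
  rw [preRenorm_piece hx, hP]
  rw [hP] at hcases
  rcases hcases with ⟨h2, h3⟩ | ⟨h2, h3⟩ | ⟨h2, h3⟩ <;> rw [h3]
  · exact F.space_center hA hAB hε' Q hlp hpc hcq hqr hp hq h1 huw h2
  · exact F.space_right hA hAB hε' Q hpc hcq hqr hp hq h1 huw h2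
  · exact F.space_left hA hAB hε' Q hlp hpc hcq hp hq h1 huw h2

theorem space_hitSet_chain (L : IsLevel f c l r E G u w H) {C x : ℝ} {n : ℕ} (hC : 0 < C)
    (hn : G.IsFirst (G.piece c) x n) (h : Space C (G.piece c) G.target) :
    Space (2 * C + C ^ 2) (G.hitSet c x n) (G.chain (G.toFun x) (n - 1)) :=
  (L.chain_onto hn.noncentral).space_preimage hC h

theorem space_hitSet (L : IsLevel f c l r E G u w H) {C x : ℝ} {n : ℕ} (hC : 0 < C)
    (hn : G.IsFirst (G.piece c) x n) (h : Space C (G.piece c) G.target) :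
    Space (2 * C + C ^ 2) (G.hitSet c x n) G.target :=
  (L.space_hitSet_chain hC hn h).mono_subset (by positivity) (L.hitSet_onto hn).isIoo_left
    L.isIoo_target subset_rfl fun _ hz => hz.1

theorem space_chain_succ (L : IsLevel f c l r E G u w H) {ε x : ℝ} {n i : ℕ} (hε : 0 < ε)
    (hn : G.IsFirst (G.piece c) x n) (hi : i + 1 < n)
    (h : Space ε (G.piece (G.toFun^[i + 1] x)) G.target) :
    Space (2 * ε + ε ^ 2) (G.chain (G.toFun x) (i + 1)) (G.chain (G.toFun x) i) := by
  rw [chain_succ]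
  exact (L.chain_onto fun j hj => hn.noncentral j (by omega)).space_preimage hε h

/-- A small piece on the way back gives space around the image of the piece of the return map. -/
theorem space_hitSet_of_visit (L : IsLevel f c l r E G u w H) {ε x : ℝ} {n i : ℕ} (hε : 0 < ε)
    (hn : G.IsFirst (G.piece c) x n) (hi : i + 1 < n)
    (h : Space ε (G.piece (G.toFun^[i + 1] x)) G.target) :
    Space (2 * ε + ε ^ 2) (G.hitSet c x n) G.target :=
  (L.space_chain_succ hε hn hi h).mono_subset (by positivity) (L.hitSet_onto hn).isIoo_left
    L.isIoo_target (fun _ hz => chain_antitone G _ (by omega) hz.1) fun _ hz => hz.1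

/-- A long return time gives large space. -/
theorem space_hitSet_of_time (L : IsLevel f c l r E G u w H) {C x : ℝ} {n : ℕ} (hC : 0 < C)
    (hn : G.IsFirst (G.piece c) x n) (h : ∀ y ∈ G.dom, Space C (G.piece y) G.target) :
    Space ((2 * C + C ^ 2) / n) (G.hitSet c x n) G.target := by
  have hκ : 0 < 2 * C + C ^ 2 := by positivity
  have key : ∀ i, i + 1 ≤ n → NestedSpace i (2 * C + C ^ 2) (G.chain (G.toFun x) i) G.target := by
    intro i
    induction i with
    | zero => intro _; rw [chain_zero]; exact NestedSpace.zero L.isIoo_target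
    | succ i ih =>
      intro hi
      exact (ih (by omega)).step hκ (L.space_chain_succ hC hn (by omega) (h _ (hn.mem_dom (by omega))))
  have h1 := hn.1.1
  have := (key (n - 1) (by omega)).step hκ (L.space_hitSet_chain hC hn (h c L.mem_dom))
  rw [Nat.sub_add_cancel h1] at this
  exact this.space h1

end PartialMap.IsLevel

/-- A two-step recursion that keeps a positive sequence away from zero. -/
theorem exists_pos_le_of_recursion {η : ℕ → ℝ} {κ : ℝ} {N : ℕ} (hκ : 0 < κ)
    (hη : ∀ n, N ≤ n → 0 < η n) (h1 : ∀ n, N ≤ n → κ * η n ^ 2 ≤ η (n + 1))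
    (h2 : ∀ n, N ≤ n → κ * η n ≤ η (n + 1) ^ 2 ∨ κ * η n ≤ η (n + 1) * η (n + 2)) :
    ∃ θ, 0 < θ ∧ ∀ n, N ≤ n → θ ≤ η n := by
  set θ := min (η N) (min κ (κ ^ 3)) with hθ
  have hθ0 : 0 < θ := lt_min (hη N le_rfl) (lt_min hκ (by positivity))
  have hθN : θ ≤ η N := min_le_left _ _
  have hθκ : θ ≤ κ := (min_le_right _ _).trans (min_le_left _ _)
  have hθκ3 : θ ≤ κ ^ 3 := (min_le_right _ _).trans (min_le_right _ _)
  have key : ∀ k, θ ≤ η (N + k) ∨ θ ≤ η (N + k + 1) := by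
    intro k
    induction k with
    | zero => exact Or.inl hθN
    | succ k ih =>
      rw [show N + (k + 1) = N + k + 1 by ring]
      rcases ih with ih | ih
      swap
      · exact Or.inl ih
      by_contra! hcon
      obtain ⟨hc1, hc2⟩ := hcon
      have p0 := hη (N + k) (by omega)
      have p1 := hη (N + k + 1) (by omega)
      have p2 := hη (N + k + 2) (by omega)
      rcases h2 (N + k) (by omega) with h | h
      · have i1 : κ * θ ≤ κ * η (N + k) := by gcongr
        have i2 : η (N + k + 1) ^ 2 < θ ^ 2 := by gcongr
        nlinarith
      · have hc2' : η (N + k + 2) < θ := hc2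
        have i1 : κ * η (N + k + 1) ^ 2 ≤ η (N + k + 2) := h1 (N + k + 1) (by omega)
        have i2 : κ * θ ≤ η (N + k + 1) * η (N + k + 2) :=
          (mul_le_mul_of_nonneg_left ih hκ.le).trans h
        have i3 : (κ * θ) ^ 2 ≤ (η (N + k + 1) * η (N + k + 2)) ^ 2 := by gcongr
        have i4 : κ * (κ * θ) ^ 2 ≤ η (N + k + 2) * η (N + k + 2) ^ 2 := by
          calc κ * (κ * θ) ^ 2 ≤ κ * (η (N + k + 1) * η (N + k + 2)) ^ 2 := by gcongr
            _ = κ * η (N + k + 1) ^ 2 * η (N + k + 2) ^ 2 := by ring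
            _ ≤ _ := by gcongr
        have i5 : η (N + k + 2) * η (N + k + 2) ^ 2 < θ * θ ^ 2 := by gcongr
        have i6 : κ ^ 3 * θ ^ 2 < θ * θ ^ 2 := by nlinarith
        have := lt_of_mul_lt_mul_right i6 (by positivity)
        linarith
  refine ⟨min θ (κ * θ ^ 2), lt_min hθ0 (by positivity), fun n hn => ?_⟩
  obtain ⟨k, rfl⟩ := Nat.exists_eq_add_of_le hn
  rcases Nat.eq_zero_or_pos k with rfl | hk
  · exact (min_le_left _ _).trans hθN
  obtain ⟨j, rfl⟩ : ∃ j, k = j + 1 := ⟨k - 1, by omega⟩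
  rcases key j with h | h
  · refine (min_le_right _ _).trans (le_trans ?_ (h1 (N + j) (by omega)))
    gcongr
  · exact (min_le_left _ _).trans h

/-- The position of the critical value `v = H y` outside of `(a₀, b₀)` controls the pull-backs of
`(a₁, b₁)` and of a component of its complement. -/
theorem Onto.gap_estimates_of_mono {H : ℝ → ℝ} {û ŵ u' w' w w'' û'' ŵ'' y a₀ b₀ a₁ b₁ a₂ b₂ g g' : ℝ}
    (hO : Onto H (Ioo û ŵ) (Ioo a₂ b₂)) (hm : StrictMonoOn H (Ioo û ŵ))
    (hO' : Onto H (Ioo u' w') (Ioo a₁ b₁)) (hû : û ≤ u') (hŵ : w' ≤ ŵ) (hŵw : ŵ ≤ w)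
    (hy : y ∈ Ioo u' w') (hg : 0 < g) (ha : g ≤ a₁ - a₂) (hb : g ≤ b₂ - b₁)
    (ha' : a₀ - a₁ ≤ g') (hb' : b₁ - b₀ ≤ g') (ha0 : a₁ ≤ a₀) (hb0 : b₀ ≤ b₁) (hab : a₀ < b₀)
    (hy'' : y ∈ Ioo û'' ŵ'') (hw'' : w'' ≤ ŵ'') (hw''y : y < w'')
    (hw''w : w'' < w') (hout : ∀ z ∈ Ioo û'' ŵ'', H z ∉ Ioo a₀ b₀) :
    (w' - y) * (g * g) ≤ (b₂ - a₂) * (b₂ - a₂) * (w - w') ∧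
      ((w' - y) * ((b₀ - a₀) * g) ≤ g' * (b₂ - a₂) * (w - w') ∨
        (w'' - y) * (g * (b₀ - a₀)) ≤ g' * (b₂ - a₂) * (w' - w'')) := by
  have hsubV : Ioo u' w' ⊆ Ioo û ŵ := Ioo_subset_Ioo hû hŵ
  have hyV := hsubV hy
  have hv := hO'.bij.mapsTo hy
  have hyw := hy.2
  have huy := hyV.1
  -- the right endpoint of the inner interval
  obtain ⟨hw'V, hHw'⟩ : w' ∈ Ioo û ŵ ∧ H w' = b₁ := by
    obtain ⟨z, hz, hzb⟩ := hO.bij.surjOn (show b₁ ∈ Ioo a₂ b₂ from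
      ⟨by linarith [hv.1, hv.2], by linarith⟩)
    have hle : w' ≤ z := by
      by_contra hlt
      push Not at hlt
      have hyz : y < z := (hm.lt_iff_lt hyV hz).1 (by rw [hzb]; exact hv.2)
      have := hO'.bij.mapsTo (show z ∈ Ioo u' w' from ⟨hy.1.trans hyz, hlt⟩)
      exact lt_irrefl _ (hzb ▸ this.2)
    have hw'V : w' ∈ Ioo û ŵ := ⟨huy.trans hyw, hle.trans_lt hz.2⟩
    refine ⟨hw'V, ?_⟩
    rcases hle.eq_or_lt with h | h
    · rw [h, hzb]
    · have h1 : H w' < b₁ := hzb ▸ hm hw'V hz h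
      have h2 : H y < H w' := hm hyV hw'V hyw
      obtain ⟨x, hx, hxe⟩ := hO'.bij.surjOn (show H w' ∈ Ioo a₁ b₁ from ⟨hv.1.trans h2, h1⟩)
      have := hO.bij.injOn (hsubV hx) hw'V hxe
      exact absurd hx.2 (by rw [this]; exact lt_irrefl _)
  set v := H y with hvdef
  have hv1 := hv.1
  have hv2 := hv.2
  have hD : 0 < b₂ - a₂ := by linarith
  have base : (w' - y) * ((v - a₂) * (b₂ - b₁)) ≤ (b₁ - v) * (b₂ - a₂) * (w - w') := by
    have i := hO.crossRatio_le hm hyV hw'V hyw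
    rw [hHw'] at i
    have hT : 0 < ŵ - û := by linarith [hyV.2]
    refine le_of_mul_le_mul_right ?_ hT
    have j : (y - û) * (ŵ - w') ≤ (ŵ - û) * (w - w') := by
      have := hw'V.2
      gcongr
      linarith
    have := mul_le_mul_of_nonneg_left j
      (mul_nonneg (sub_nonneg.2 hv2.le) hD.le : 0 ≤ (b₁ - v) * (b₂ - a₂))
    linarith
  have hww' : 0 ≤ w - w' := by linarith [hw'V.2]
  have hwy : 0 ≤ w' - y := by linarith
  refine ⟨?_, ?_⟩
  · calc (w' - y) * (g * g) ≤ (w' - y) * ((v - a₂) * (b₂ - b₁)) := by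
          gcongr <;> linarith
      _ ≤ (b₁ - v) * (b₂ - a₂) * (w - w') := base
      _ ≤ _ := by
          gcongr <;> linarith
  have hv0 : v ≤ a₀ ∨ b₀ ≤ v := by
    by_contra! hcon
    exact hout y hy'' hcon
  rcases hv0 with hv0 | hv0
  · right
    have hw''V : w'' ∈ Ioo û ŵ := ⟨huy.trans hw''y, hw''w.trans hw'V.2⟩
    have hHw'' : H w'' ≤ a₀ := by
      by_contra! hcon
      obtain ⟨t, ht1, ht2⟩ := exists_between (lt_min hcon hab)
      obtain ⟨z, hz, rfl⟩ := hO.bij.surjOn (show t ∈ Ioo a₂ b₂ from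
        ⟨by linarith, by linarith [min_le_right (H w'') b₀]⟩)
      have hzw : z < w'' := (hm.lt_iff_lt hz hw''V).1 (ht2.trans_le (min_le_left _ _))
      have hyz : y < z := (hm.lt_iff_lt hyV hz).1 (hv0.trans_lt ht1)
      exact hout z ⟨hy''.1.trans hyz, hzw.trans_le hw''⟩ ⟨ht1, ht2.trans_le (min_le_right _ _)⟩
    have hset : Ioo û ŵ ∩ H ⁻¹' Ioo a₂ b₁ = Ioo û w' := by
      ext z
      constructor
      · rintro ⟨hz, hz1⟩
        exact ⟨hz.1, (hm.lt_iff_lt hz hw'V).1 (by rw [hHw']; exact hz1.2)⟩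
      · rintro ⟨hz1, hz2⟩
        have hz : z ∈ Ioo û ŵ := ⟨hz1, hz2.trans hw'V.2⟩
        exact ⟨hz, (hO.bij.mapsTo hz).1, hHw' ▸ hm hz hw'V hz2⟩
    have hR := hO.restrict (U := Ioo a₂ b₁) ⟨_, _, by linarith, rfl⟩
      (Ioo_subset_Ioo_right (by linarith))
    rw [hset] at hR
    have hmR := hm.mono (show Ioo û w' ⊆ Ioo û ŵ from Ioo_subset_Ioo_right hŵ)
    have i := hR.crossRatio_le hmR ⟨huy, hyw⟩ ⟨hw''V.1, hw''w⟩ hw''y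
    rw [← hvdef] at i
    have hvw : v < H w'' := hm hyV hw''V hw''y
    have hT : 0 < w' - û := by linarith
    have base' : (w'' - y) * ((v - a₂) * (b₁ - H w'')) ≤
        (H w'' - v) * (b₁ - a₂) * (w' - w'') := by
      refine le_of_mul_le_mul_right ?_ hT
      have j : (y - û) * (w' - w'') ≤ (w' - û) * (w' - w'') := by gcongr
      have := mul_le_mul_of_nonneg_left j
        (mul_nonneg (sub_nonneg.2 hvw.le) (by linarith) : 0 ≤ (H w'' - v) * (b₁ - a₂))
      linarith
    have hw0 : 0 ≤ w' - w'' := by linarith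
    have hwy'' : 0 ≤ w'' - y := by linarith
    have hg0 : 0 ≤ g' := by linarith
    calc (w'' - y) * (g * (b₀ - a₀)) ≤ (w'' - y) * ((v - a₂) * (b₁ - H w'')) := by
          have : 0 ≤ b₀ - a₀ := by linarith
          have : 0 ≤ v - a₂ := by linarith
          gcongr
          linarith
      _ ≤ (H w'' - v) * (b₁ - a₂) * (w' - w'') := base'
      _ ≤ _ := by
          have : 0 ≤ b₁ - a₂ := by linarith
          gcongr
          · linarith
          · linarith
  · left
    have hg0 : 0 ≤ g' := by linarith
    calc (w' - y) * ((b₀ - a₀) * g) ≤ (w' - y) * ((v - a₂) * (b₂ - b₁)) := by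
          have : 0 ≤ v - a₂ := by linarith
          gcongr
          linarith
      _ ≤ (b₁ - v) * (b₂ - a₂) * (w - w') := base
      _ ≤ _ := by
          gcongr
          linarith

theorem Onto.gap_estimates {H : ℝ → ℝ} {û ŵ u' w' w w'' û'' ŵ'' y a₀ b₀ a₁ b₁ a₂ b₂ g g' : ℝ}
    (hO : Onto H (Ioo û ŵ) (Ioo a₂ b₂))
    (hO' : Onto H (Ioo u' w') (Ioo a₁ b₁)) (hû : û ≤ u') (hŵ : w' ≤ ŵ) (hŵw : ŵ ≤ w)
    (hy : y ∈ Ioo u' w') (hg : 0 < g) (ha : g ≤ a₁ - a₂) (hb : g ≤ b₂ - b₁)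
    (ha' : a₀ - a₁ ≤ g') (hb' : b₁ - b₀ ≤ g') (ha0 : a₁ ≤ a₀) (hb0 : b₀ ≤ b₁) (hab : a₀ < b₀)
    (hy'' : y ∈ Ioo û'' ŵ'') (hw'' : w'' ≤ ŵ'') (hw''y : y < w'')
    (hw''w : w'' < w') (hout : ∀ z ∈ Ioo û'' ŵ'', H z ∉ Ioo a₀ b₀) :
    (w' - y) * (g * g) ≤ (b₂ - a₂) * (b₂ - a₂) * (w - w') ∧
      ((w' - y) * ((b₀ - a₀) * g) ≤ g' * (b₂ - a₂) * (w - w') ∨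
        (w'' - y) * (g * (b₀ - a₀)) ≤ g' * (b₂ - a₂) * (w' - w'')) := by
  rcases hO.mono_or_anti with hm | hm
  · exact hO.gap_estimates_of_mono hm hO' hû hŵ hŵw hy hg ha hb ha' hb' ha0 hb0 hab hy'' hw''
      hw''y hw''w hout
  · have := hO.neg.gap_estimates_of_mono hm.neg hO'.neg hû hŵ hŵw hy hg (by linarith) (by linarith)
      (a₀ := -b₀) (b₀ := -a₀) (g' := g')
      (by linarith) (by linarith) (by linarith) (by linarith) (by linarith) hy'' hw''
      hw''y hw''w (fun z hz hmem => hout z hz ⟨by linarith [hmem.2], by linarith [hmem.1]⟩)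
    have e1 : -a₂ - -b₂ = b₂ - a₂ := by ring
    have e2 : -a₀ - -b₀ = b₀ - a₀ := by ring
    rwa [e1, e2] at this

namespace PartialMap

/-- A sequence of successive pre-renormalizations without central returns, with the
factorizations `G n = H n ∘ f` of the central branches. -/
structure Tower (f : ℝ → ℝ) (c l r E : ℝ) (G : ℕ → PartialMap) (u w û ŵ : ℕ → ℝ)
    (H : ℕ → ℝ → ℝ) : Prop where
  fold : Fold f c l r E
  isLevel : ∀ n, IsLevel f c l r E (G n) (u n) (w n) (H n)
  succ : ∀ n, G (n + 1) = (G n).preRenorm c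
  noncentral : ∀ n, (G n).toFun c ∉ (G n).piece c
  hat_u : ∀ n, û (n + 1) ≤ u (n + 1)
  hat_w : ∀ n, w (n + 1) ≤ ŵ (n + 1)
  hat_w_le : ∀ n, ŵ (n + 1) ≤ w n
  mem_hat : ∀ n, f c ∈ Ioo (û (n + 1)) (ŵ (n + 1))
  onto_hat : ∀ n, Onto (H (n + 1)) (Ioo (û (n + 1)) (ŵ (n + 1))) (G n).target
  avoid : ∀ n, ∀ z ∈ Ioo (û (n + 1)) (ŵ (n + 1)), H n z ∉ (G n).piece c

theorem exists_tower {f : ℝ → ℝ} {c l r E u₀ w₀ : ℝ} {H₀ : ℝ → ℝ} (F : Fold f c l r E)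
    {G : ℕ → PartialMap} (L : IsLevel f c l r E (G 0) u₀ w₀ H₀)
    (hsucc : ∀ n, G (n + 1) = (G n).preRenorm c) (hnc : ∀ n, (G n).toFun c ∉ (G n).piece c) :
    ∃ u w û ŵ H, Tower f c l r E G u w û ŵ H := by
  let S : ℕ → Type := fun n =>
    {d : ℝ × ℝ × ℝ × ℝ × (ℝ → ℝ) // IsLevel f c l r E (G n) d.1 d.2.1 d.2.2.2.2}
  have step : ∀ n (d : S n), ∃ d' : S (n + 1), d'.1.2.2.1 ≤ d'.1.1 ∧ d'.1.2.1 ≤ d'.1.2.2.2.1 ∧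
      d'.1.2.2.2.1 ≤ d.1.2.1 ∧ f c ∈ Ioo d'.1.2.2.1 d'.1.2.2.2.1 ∧
      Onto d'.1.2.2.2.2 (Ioo d'.1.2.2.1 d'.1.2.2.2.1) (G n).target ∧
      ∀ z ∈ Ioo d'.1.2.2.1 d'.1.2.2.2.1, d.1.2.2.2.2 z ∉ (G n).piece c := by
    rintro n ⟨d, hd⟩
    obtain ⟨u', w', û, ŵ, H', h1, h2, h3, h4, h5, h6, -, h7, h8⟩ := hd.preRenorm F (hnc n)
    rw [← hsucc] at h1
    exact ⟨⟨(u', w', û, ŵ, H'), h1⟩, h2, h3, h4, ⟨h5, h6⟩, h7, h8⟩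
  choose nxt hnxt using step
  let seq : ∀ n, S n := fun n => Nat.rec ⟨(u₀, w₀, 0, 0, H₀), L⟩ nxt n
  have hseq : ∀ n, seq (n + 1) = nxt n (seq n) := fun n => rfl
  refine ⟨fun n => (seq n).1.1, fun n => (seq n).1.2.1, fun n => (seq n).1.2.2.1,
    fun n => (seq n).1.2.2.2.1, fun n => (seq n).1.2.2.2.2, F, fun n => (seq n).2, hsucc, hnc,
    fun n => ?_, fun n => ?_, fun n => ?_, fun n => ?_, fun n => ?_, fun n => ?_⟩ <;>
    simp only [hseq]
  · exact (hnxt n (seq n)).1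
  · exact (hnxt n (seq n)).2.1
  · exact (hnxt n (seq n)).2.2.1
  · exact (hnxt n (seq n)).2.2.2.1
  · exact (hnxt n (seq n)).2.2.2.2.1
  · exact (hnxt n (seq n)).2.2.2.2.2

namespace Tower

variable {f : ℝ → ℝ} {c l r E : ℝ} {G : ℕ → PartialMap} {u w û ŵ : ℕ → ℝ} {H : ℕ → ℝ → ℝ}

theorem target_succ (T : Tower f c l r E G u w û ŵ H) (n : ℕ) :
    (G (n + 1)).target = (G n).piece c := by rw [T.succ]; rfl

theorem w_succ_lt (T : Tower f c l r E G u w û ŵ H) (n : ℕ) : w (n + 1) < w n := by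
  refine lt_of_le_of_ne ((T.hat_w n).trans (T.hat_w_le n)) fun h => T.noncentral (n + 1) ?_
  have h1 := (T.isLevel (n + 1)).mapsTo T.fold (T.isLevel (n + 1)).mem_dom
  rwa [T.target_succ, (T.isLevel n).piece_eq, ← h, ← (T.isLevel (n + 1)).piece_eq] at h1

theorem w_succ_lt_limit (T : Tower f c l r E G u w û ŵ H) (n : ℕ) : w (n + 1) < E :=
  (T.w_succ_lt n).trans_le (T.isLevel n).w_le

/-- The endpoints of the targets. -/
theorem exists_endpoints (T : Tower f c l r E G u w û ŵ H) :
    ∃ a b : ℕ → ℝ, (∀ n, a n < b n ∧ (G n).target = Ioo (a n) (b n)) ∧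
      ∀ n, l < a (n + 2) ∧ a (n + 2) < c ∧ c < b (n + 2) ∧ b (n + 2) < r ∧
        f (a (n + 2)) = w (n + 1) ∧ f (b (n + 2)) = w (n + 1) ∧
        a (n + 2) < a (n + 3) ∧ b (n + 3) < b (n + 2) := by
  choose a b hab using fun n => (T.isLevel n).isIoo_target
  have key : ∀ n, l < a (n + 2) ∧ a (n + 2) < c ∧ c < b (n + 2) ∧ b (n + 2) < r ∧
        f (a (n + 2)) = w (n + 1) ∧ f (b (n + 2)) = w (n + 1) := by
    intro n
    obtain ⟨p, q, h1, h2, h3, h4, h5, h6, h7⟩ :=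
      T.fold.sublevel (T.isLevel (n + 1)).lt_w (T.w_succ_lt_limit n)
    rw [← (T.isLevel (n + 1)).piece_eq, ← T.target_succ, (hab (n + 2)).2] at h7
    obtain ⟨rfl, rfl⟩ := Ioo_endpoints_eq (hab (n + 2)).1 h7
    exact ⟨h1, h2, h3, h4, h5, h6⟩
  refine ⟨a, b, hab, fun n => ?_⟩
  obtain ⟨h1, h2, h3, h4, h5, h6⟩ := key n
  obtain ⟨k1, k2, k3, k4, k5, k6⟩ := key (n + 1)
  have hw := T.w_succ_lt (n + 1)
  refine ⟨h1, h2, h3, h4, h5, h6, ?_, ?_⟩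
  · rw [← T.fold.anti.lt_iff_gt ⟨k1, k2.le⟩ ⟨h1, h2.le⟩]
    exact lt_of_eq_of_lt k5 (hw.trans_eq h5.symm)
  · rw [← T.fold.mono.lt_iff_lt ⟨k3.le, k4⟩ ⟨h3.le, h4⟩]
    exact lt_of_eq_of_lt k6 (hw.trans_eq h6.symm)

end Tower
end PartialMap

theorem QuadBounds.gap_bounds {f : ℝ → ℝ} {c p q A B w q' w' : ℝ} (hA : 0 < A) (hAB : A ≤ B)
    (Q : QuadBounds f c p q A B) (hpc : p < c) (hcq' : c < q') (hqq' : q' < q)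
    (hp : f p = w) (hq : f q = w) (hq' : f q' = w') :
    (w - w') / (q - p) ^ 2 * (q - p) / (2 * B) ≤ q - q' ∧
      q - q' ≤ (1 + B / A) / A * ((w - w') / (q - p) ^ 2) * (q - p) ∧
      A / (1 + B / A) ^ 2 * (q - p) ^ 2 ≤ w - f c := by
  have hB : 0 < B := hA.trans_le hAB
  have hcq : c < q := hcq'.trans hqq'
  have d := (Fold.dist_comparable hA hAB Q hpc hcq hp hq).2
  obtain ⟨i1, i2⟩ := Q.1 q' q hcq'.le hqq'.le le_rfl
  have i3 := (Q.1 c q le_rfl hcq.le le_rfl).1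
  rw [hq, hq'] at i1 i2
  rw [hq] at i3
  have hD : 0 < q - p := by linarith
  have e1 : (w - w') / (q - p) ^ 2 * (q - p) / (2 * B) = (w - w') / (2 * B * (q - p)) := by
    field_simp
  have e2 : (1 + B / A) / A * ((w - w') / (q - p) ^ 2) * (q - p) =
      (1 + B / A) * (w - w') / (A * (q - p)) := by
    field_simp
  have hk : 0 < 1 + B / A := by positivity
  set k := B / A
  have hR : q - p ≤ (1 + k) * (q - c) := by linarith
  refine ⟨?_, ?_, ?_⟩
  · rw [e1, div_le_iff₀ (by positivity)]
    calc w - w' ≤ B * ((q - c) ^ 2 - (q' - c) ^ 2) := i2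
      _ = B * ((q - q') * ((q - c) + (q' - c))) := by ring
      _ ≤ B * ((q - q') * (2 * (q - p))) := by
        gcongr; linarith
      _ = _ := by ring
  · rw [e2, le_div_iff₀ (by positivity)]
    calc (q - q') * (A * (q - p)) ≤ (q - q') * (A * ((1 + k) * (q - c))) := by
          gcongr
      _ = (1 + k) * (A * ((q - q') * (q - c))) := by ring
      _ ≤ (1 + k) * (A * ((q - c) ^ 2 - (q' - c) ^ 2)) := by
          gcongr
          nlinarith [mul_nonneg (sub_nonneg.2 hqq'.le) (sub_nonneg.2 hcq'.le)]
      _ ≤ _ := by gcongr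
  · calc A / (1 + k) ^ 2 * (q - p) ^ 2 ≤ A / (1 + k) ^ 2 * ((1 + k) * (q - c)) ^ 2 := by gcongr
      _ = A * (q - c) ^ 2 := by field_simp
      _ ≤ _ := by simpa using i3

theorem sq_le_of_gap_estimate {B D c₁ δ g t e η η' : ℝ} (hB : 0 < B) (hD : 0 < D)
    (h : t * (g * g) ≤ D * D * e) (ht : c₁ * δ ^ 4 * D ^ 2 ≤ t) (he : e ≤ η' * D ^ 2)
    (hg : g = η * D / (2 * B)) : c₁ * δ ^ 4 / (4 * B ^ 2) * η ^ 2 ≤ η' := by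
  refine le_of_mul_le_mul_right ?_ (pow_pos hD 4)
  calc c₁ * δ ^ 4 / (4 * B ^ 2) * η ^ 2 * D ^ 4 = c₁ * δ ^ 4 * D ^ 2 * (g * g) := by
        rw [hg]; field_simp; ring
    _ ≤ t * (g * g) := mul_le_mul_of_nonneg_right ht (mul_self_nonneg g)
    _ ≤ D * D * e := h
    _ ≤ D * D * (η' * D ^ 2) := by gcongr
    _ = _ := by ring

theorem le_mul_of_gap_estimate {A B k D D' c₁ δ g g' t e η η₁ η' : ℝ} (hA : 0 < A) (hB : 0 < B)
    (hk : 0 < 1 + k) (hD : 0 < D) (hc₁ : 0 < c₁) (hδ : 0 < δ) (hη : 0 < η) (hη₁ : 0 < η₁)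
    (he0 : 0 ≤ e)
    (h : t * (D' * g) ≤ g' * D * e) (ht : c₁ * δ ^ 6 * D ^ 2 ≤ t) (hD' : δ ^ 2 * D ≤ D')
    (he : e ≤ η' * D ^ 2) (hg : g = η * D / (2 * B)) (hg' : g' ≤ (1 + k) / A * η₁ * D) :
    c₁ * δ ^ 8 / (2 * B) * (A / (1 + k)) * η ≤ η₁ * η' := by
  have hg0 : 0 < g := by rw [hg]; positivity
  have ht0 : 0 ≤ t := le_trans (by positivity) ht
  have key : c₁ * δ ^ 8 / (2 * B) * η * D ^ 4 ≤ (1 + k) / A * η₁ * η' * D ^ 4 := by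
    calc c₁ * δ ^ 8 / (2 * B) * η * D ^ 4 = c₁ * δ ^ 6 * D ^ 2 * (δ ^ 2 * D * g) := by
          rw [hg]; field_simp
      _ ≤ t * (D' * g) := by gcongr
      _ ≤ g' * D * e := h
      _ ≤ (1 + k) / A * η₁ * D * D * e := by gcongr
      _ ≤ (1 + k) / A * η₁ * D * D * (η' * D ^ 2) := by gcongr
      _ = _ := by ring
  have key' := le_of_mul_le_mul_right key (pow_pos hD 4)
  calc c₁ * δ ^ 8 / (2 * B) * (A / (1 + k)) * η
      = A / (1 + k) * (c₁ * δ ^ 8 / (2 * B) * η) := by ring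
    _ ≤ A / (1 + k) * ((1 + k) / A * η₁ * η') := by gcongr
    _ = _ := by field_simp

namespace PartialMap.Tower

variable {f : ℝ → ℝ} {c l r E : ℝ} {G : ℕ → PartialMap} {u w û ŵ : ℕ → ℝ} {H : ℕ → ℝ → ℝ}

/-- A priori bounds: the central intervals have definite space. -/
theorem exists_space (T : Tower f c l r E G u w û ŵ H) {a b : ℕ → ℝ} {δ A B : ℝ}
    (hab : ∀ n, a n < b n ∧ (G n).target = Ioo (a n) (b n))
    (hend : ∀ n, l < a (n + 2) ∧ a (n + 2) < c ∧ c < b (n + 2) ∧ b (n + 2) < r ∧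
        f (a (n + 2)) = w (n + 1) ∧ f (b (n + 2)) = w (n + 1) ∧
        a (n + 2) < a (n + 3) ∧ b (n + 3) < b (n + 2))
    (hA : 0 < A) (hAB : A ≤ B) (Q : ∀ n, QuadBounds f c (a (n + 2)) (b (n + 2)) A B)
    (hδ : 0 < δ) (hscale : ∀ n, δ * (b n - a n) ≤ b (n + 1) - a (n + 1)) :
    ∃ C, 0 < C ∧ ∀ n, Space C ((G (n + 2)).piece c) (G (n + 2)).target := by
  have hB : 0 < B := hA.trans_le hAB
  have hk : 0 < 1 + B / A := by positivity
  set k := B / A with hkdef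
  set c₁ := A / (1 + k) ^ 2 with hc₁
  have hc₁0 : 0 < c₁ := by positivity
  set D : ℕ → ℝ := fun n => b (n + 2) - a (n + 2) with hDdef
  have hD : ∀ n, 0 < D n := fun n => sub_pos.2 (hab (n + 2)).1
  have hDlt : ∀ n, D (n + 1) < D n := fun n => by
    obtain ⟨-, -, -, -, -, -, h1, h2⟩ := hend n
    simp only [hDdef]; linarith
  have hDs : ∀ n, δ * D n ≤ D (n + 1) := fun n => hscale (n + 2)
  have hδ1 : δ < 1 := by
    by_contra! hcon
    have h1 := hDs 0
    have h2 := hDlt 0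
    nlinarith [hD 0]
  set e : ℕ → ℝ := fun n => w (n + 1) - w (n + 2) with hedef
  have he : ∀ n, 0 < e n := fun n => sub_pos.2 (T.w_succ_lt (n + 1))
  set η : ℕ → ℝ := fun n => e n / D n ^ 2 with hηdef
  have hη : ∀ n, 0 < η n := fun n => div_pos (he n) (pow_pos (hD n) 2)
  have heη : ∀ n, e n = η n * D n ^ 2 := fun n => by
    have := (hD n).ne'
    simp only [hηdef]; field_simp
  have hR : ∀ n, η n * D n / (2 * B) ≤ b (n + 2) - b (n + 3) ∧
      b (n + 2) - b (n + 3) ≤ (1 + k) / A * η n * D n ∧ c₁ * D n ^ 2 ≤ w (n + 1) - f c := by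
    intro n
    obtain ⟨-, h2, -, -, h5, h6, -, h8⟩ := hend n
    obtain ⟨-, -, k3, -, -, k6, -, -⟩ := hend (n + 1)
    exact (Q n).gap_bounds hA hAB h2 k3 h8 h5 h6 k6
  have hL : ∀ n, η n * D n / (2 * B) ≤ a (n + 3) - a (n + 2) ∧
      a (n + 3) - a (n + 2) ≤ (1 + k) / A * η n * D n := by
    intro n
    obtain ⟨-, -, h3, -, h5, h6, h7, -⟩ := hend n
    obtain ⟨-, k2, -, -, k5, -, -, -⟩ := hend (n + 1)
    have := (Q n).reflect.gap_bounds hA hAB (w := w (n + 1)) (w' := w (n + 2))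
      (q' := - a (n + 3)) (by linarith) (by linarith)
      (by linarith) (by simpa using h6) (by simpa using h5) (by simpa using k5)
    have e1 : -a (n + 2) - -b (n + 2) = D n := by simp only [hDdef]; ring
    have e2 : -a (n + 2) - -a (n + 3) = a (n + 3) - a (n + 2) := by ring
    rw [e1, e2] at this
    exact ⟨this.1, this.2.1⟩
  have hD2 : ∀ n, δ ^ 2 * D n ≤ D (n + 2) := fun n => by
    have h1 := hDs n
    have h2 := hDs (n + 1)
    have := mul_le_mul_of_nonneg_left h1 hδ.le
    calc δ ^ 2 * D n = δ * (δ * D n) := by ring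
      _ ≤ δ * D (n + 1) := this
      _ ≤ _ := h2
  have hD3 : ∀ n, δ ^ 3 * D n ≤ D (n + 3) := fun n => by
    have := mul_le_mul_of_nonneg_left (hD2 n) hδ.le
    calc δ ^ 3 * D n = δ * (δ ^ 2 * D n) := by ring
      _ ≤ δ * D (n + 2) := this
      _ ≤ _ := hDs (n + 2)
  have ht2 : ∀ n, c₁ * δ ^ 4 * D n ^ 2 ≤ w (n + 3) - f c := fun n => by
    refine le_trans ?_ (hR (n + 2)).2.2
    have : (δ ^ 2 * D n) ^ 2 ≤ D (n + 2) ^ 2 :=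
      pow_le_pow_left₀ (mul_nonneg (by positivity) (hD n).le) (hD2 n) 2
    calc c₁ * δ ^ 4 * D n ^ 2 = c₁ * (δ ^ 2 * D n) ^ 2 := by ring
      _ ≤ _ := by gcongr
  have ht3 : ∀ n, c₁ * δ ^ 6 * D n ^ 2 ≤ w (n + 4) - f c := fun n => by
    refine le_trans ?_ (hR (n + 3)).2.2
    have : (δ ^ 3 * D n) ^ 2 ≤ D (n + 3) ^ 2 :=
      pow_le_pow_left₀ (mul_nonneg (by positivity) (hD n).le) (hD3 n) 2
    calc c₁ * δ ^ 6 * D n ^ 2 = c₁ * (δ ^ 3 * D n) ^ 2 := by ring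
      _ ≤ _ := by gcongr
  have main : ∀ n, c₁ * δ ^ 4 / (4 * B ^ 2) * η n ^ 2 ≤ η (n + 1) ∧
      (c₁ * δ ^ 8 / (2 * B) * (A / (1 + k)) * η n ≤ η (n + 1) * η (n + 1) ∨
        c₁ * δ ^ 8 / (2 * B) * (A / (1 + k)) * η n ≤ η (n + 1) * η (n + 2)) := by
    intro n
    have hO := T.onto_hat (n + 2)
    have hO' := (T.isLevel (n + 3)).onto
    rw [(hab (n + 2)).2] at hO
    rw [(hab (n + 3)).2] at hO'
    obtain ⟨-, -, -, -, -, -, h1, h2⟩ := hend (n + 1)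
    have hg : 0 < η n * D n / (2 * B) :=
      div_pos (mul_pos (hη n) (hD n)) (by positivity)
    have est := hO.gap_estimates hO' (T.hat_u (n + 2)) (T.hat_w (n + 2)) (T.hat_w_le (n + 2))
      (y := f c) (g := η n * D n / (2 * B)) (g' := (1 + k) / A * η (n + 1) * D (n + 1))
      (a₀ := a (n + 4)) (b₀ := b (n + 4)) (û'' := û (n + 4)) (ŵ'' := ŵ (n + 4)) (w'' := w (n + 4))
      ⟨(T.isLevel (n + 3)).u_lt, (T.isLevel (n + 3)).lt_w⟩ hg (hL n).1 (hR n).1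
      (hL (n + 1)).2 (hR (n + 1)).2.1 h1.le h2.le (hab (n + 4)).1 (T.mem_hat (n + 3))
      (T.hat_w (n + 3)) (T.isLevel (n + 4)).lt_w (T.w_succ_lt (n + 3))
      (by rw [← (hab (n + 4)).2, T.target_succ]; exact T.avoid (n + 3))
    obtain ⟨est1, est2⟩ := est
    have hDn : D (n + 1) ^ 2 ≤ D n ^ 2 := pow_le_pow_left₀ (hD _).le (hDlt n).le 2
    have hDn2 : D (n + 2) ^ 2 ≤ D n ^ 2 :=
      pow_le_pow_left₀ (hD _).le ((hDlt (n + 1)).trans (hDlt n)).le 2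
    have he1 : w (n + 2) - w (n + 3) ≤ η (n + 1) * D n ^ 2 :=
      (heη (n + 1)).le.trans (mul_le_mul_of_nonneg_left hDn (hη _).le)
    have he2 : w (n + 3) - w (n + 4) ≤ η (n + 2) * D n ^ 2 :=
      (heη (n + 2)).le.trans (mul_le_mul_of_nonneg_left hDn2 (hη _).le)
    have hg' : (1 + k) / A * η (n + 1) * D (n + 1) ≤ (1 + k) / A * η (n + 1) * D n :=
      mul_le_mul_of_nonneg_left (hDlt n).le
        (mul_nonneg (by positivity) (hη _).le)
    refine ⟨sq_le_of_gap_estimate hB (hD n) est1 (ht2 n) he1 rfl, ?_⟩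
    rcases est2 with est2 | est2
    · left
      refine le_mul_of_gap_estimate hA hB hk (hD n) hc₁0 hδ (hη n) (hη _) (he (n + 1)).le est2 ?_
        (hD2 n) he1 rfl hg'
      refine le_trans ?_ (ht2 n)
      have : δ ^ 6 ≤ δ ^ 4 := pow_le_pow_of_le_one hδ.le hδ1.le (by norm_num)
      gcongr
    · right
      rw [mul_comm (η n * D n / (2 * B))] at est2
      exact le_mul_of_gap_estimate hA hB hk (hD n) hc₁0 hδ (hη n) (hη _) (he (n + 2)).le est2
        (ht3 n) (hD2 n) he2 rfl hg'
  set κ := min (c₁ * δ ^ 4 / (4 * B ^ 2)) (c₁ * δ ^ 8 / (2 * B) * (A / (1 + k)))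
  have hκ : 0 < κ := lt_min (by positivity) (by positivity)
  obtain ⟨θ, hθ, hθη⟩ := exists_pos_le_of_recursion (N := 0) hκ (fun n _ => hη n)
    (fun n _ => le_trans (mul_le_mul_of_nonneg_right (min_le_left _ _) (sq_nonneg _)) (main n).1)
    (fun n _ => by
      have h : κ * η n ≤ c₁ * δ ^ 8 / (2 * B) * (A / (1 + k)) * η n :=
        mul_le_mul_of_nonneg_right (min_le_right _ _) (hη n).le
      rw [sq]
      exact (main n).2.imp h.trans h.trans)
  refine ⟨2 * B / θ, by positivity, fun n => ?_⟩
  rw [← T.target_succ, (hab (n + 3)).2, (hab (n + 2)).2]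
  have hb : D n ≤ 2 * B / θ * (η n * D n / (2 * B)) := by
    have e1 : 2 * B / θ * (η n * D n / (2 * B)) = η n / θ * D n := by field_simp
    rw [e1]
    have : 1 ≤ η n / θ := (one_le_div hθ).2 (hθη n n.zero_le)
    nlinarith [hD n]
  have hlt : b (n + 3) - a (n + 3) ≤ D n := (hDlt n).le
  refine ⟨_, _, _, _, rfl, rfl, (hab (n + 3)).1, ?_, ?_⟩
  · exact hlt.trans (hb.trans (mul_le_mul_of_nonneg_left (hL n).1 (by positivity)))
  · exact hlt.trans (hb.trans (mul_le_mul_of_nonneg_left (hR n).1 (by positivity)))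

end PartialMap.Tower

theorem exists_foldLoss_lt (k : ℝ) {ε : ℝ} (hε : 0 < ε) :
    ∃ a, 0 < a ∧ foldLoss k (2 * a + a ^ 2) < ε := by
  have hcont : Continuous fun a : ℝ => foldLoss k (2 * a + a ^ 2) := by
    unfold foldLoss; fun_prop
  have h0 : foldLoss k (2 * 0 + 0 ^ 2) = 0 := by simp [foldLoss]
  have hev : ∀ᶠ a in 𝓝[>] (0 : ℝ), foldLoss k (2 * a + a ^ 2) < ε :=
    ((hcont.tendsto' 0 0 h0).eventually (gt_mem_nhds hε)).filter_mono nhdsWithin_le_nhds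
  obtain ⟨a, ha1, ha2⟩ := (hev.and self_mem_nhdsWithin).exists
  exact ⟨a, ha2, ha1⟩

theorem foldLoss_pos {k ε : ℝ} (hk : 0 < k) (hε : 0 < ε) : 0 < foldLoss k ε := by
  unfold foldLoss
  have := Real.sqrt_nonneg ε
  positivity

namespace PartialMap.Tower

variable {f : ℝ → ℝ} {c l r E : ℝ} {G : ℕ → PartialMap} {u w û ŵ : ℕ → ℝ} {H : ℕ → ℝ → ℝ}

/-- The critical orbit of `G (j + 3)` comes to the deeper central interval in a bounded number of
steps, and on the way visits only pieces of definite size. -/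
theorem exists_bounded_return (T : Tower f c l r E G u w û ŵ H) {a b : ℕ → ℝ} {δ : ℝ}
    (hab : ∀ n, a n < b n ∧ (G n).target = Ioo (a n) (b n))
    (hend : ∀ n, l < a (n + 2) ∧ a (n + 2) < c ∧ c < b (n + 2) ∧ b (n + 2) < r ∧
        f (a (n + 2)) = w (n + 1) ∧ f (b (n + 2)) = w (n + 1) ∧
        a (n + 2) < a (n + 3) ∧ b (n + 3) < b (n + 2))
    (hδ : 0 < δ) (hscale : ∀ n, δ * (b n - a n) ≤ b (n + 1) - a (n + 1)) (k : ℕ) :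
    ∃ (N : ℕ) (ε : ℝ), 0 < ε ∧ ∀ j, ∃ p, 1 ≤ p ∧ p ≤ N ∧
      (G (j + 3)).toFun^[p] c ∈ (G (j + 3 + k)).target ∧
      ∀ i < p, ¬ Space ε ((G (j + 3)).piece ((G (j + 3)).toFun^[i] c)) (G (j + 3)).target := by
  obtain ⟨A, B, hA, hAB, Q0⟩ := T.fold.quad (a 2) (b 2) (hend 0).1 (hend 0).2.1 (hend 0).2.2.1
    (hend 0).2.2.2.1
  have hanti : ∀ n, a 2 ≤ a (n + 2) ∧ b (n + 2) ≤ b 2 := by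
    intro n
    induction n with
    | zero => exact ⟨le_rfl, le_rfl⟩
    | succ n ih =>
      obtain ⟨-, -, -, -, -, -, h1, h2⟩ := hend n
      exact ⟨ih.1.trans h1.le, h2.le.trans ih.2⟩
  have Q : ∀ n, QuadBounds f c (a (n + 2)) (b (n + 2)) A B := fun n =>
    Q0.mono (hanti n).1 (hanti n).2
  obtain ⟨C, hC, hspace⟩ := T.exists_space hab hend hA hAB Q hδ hscale
  have hκ : 0 < B / A := div_pos (hA.trans_le hAB) hA
  have pull : ∀ j x q ε, 0 < ε → x ∈ (G (j + 3)).dom →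
      (G (j + 2)).IsFirst ((G (j + 2)).piece c) x q →
      Space ε ((G (j + 2)).hitSet c x q) (G (j + 2)).target →
      Space (foldLoss (B / A) (2 * ε + ε ^ 2)) ((G (j + 3)).piece x) (G (j + 3)).target := by
    intro j x q ε hε hx hq h
    obtain ⟨h1, h2, h3, h4, h5, h6, -, -⟩ := hend (j + 1)
    have hx' := hx
    rw [T.succ (j + 2)] at hx'
    have := (T.isLevel (j + 2)).space_piece T.fold hA hAB hε (Q (j + 1)) h1 h4 h2 h3
      (by rw [← T.target_succ, (hab (j + 3)).2]) h5 h6 hx' hq h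
    rw [T.target_succ, T.succ (j + 2)]
    exact this
  have hfirst : ∀ j x, x ∈ (G (j + 1)).dom → x ∈ (G j).piece c ∧
      ∃ q, (G j).IsFirst ((G j).piece c) x q ∧ (G (j + 1)).toFun x = (G j).toFun^[q] x := by
    intro j x hx
    rw [T.succ j] at hx
    obtain ⟨h1, q, hq⟩ := mem_returnDom_iff.1 hx.1
    exact ⟨h1, q, hq, by rw [T.succ j, IsLevel.preRenorm_apply hq]⟩
  have hC' : 0 < 2 * C + C ^ 2 := by positivity
  set C₁ := foldLoss (B / A) (2 * (2 * C + C ^ 2) + (2 * C + C ^ 2) ^ 2)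
  have hC₁ : 0 < C₁ := foldLoss_pos hκ (by positivity)
  have hpieces : ∀ j x, x ∈ (G (j + 3)).dom →
      Space C₁ ((G (j + 3)).piece x) (G (j + 3)).target := by
    intro j x hx
    obtain ⟨-, q, hq, -⟩ := hfirst (j + 2) x hx
    exact pull j x q _ hC' hx hq ((T.isLevel (j + 2)).space_hitSet hC hq (hspace j))
  have hcenter : ∀ j ε, 0 < ε → ε < δ → ¬ Space ε ((G j).piece c) (G j).target := by
    intro j ε hε hεδ h
    rw [← T.target_succ, (hab (j + 1)).2, (hab j).2] at h
    obtain ⟨t₁, m₁, m₂, t₂, e1, e2, hm, h1, h2⟩ := h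
    obtain ⟨rfl, rfl⟩ := Ioo_endpoints_eq hm e1.symm
    obtain ⟨rfl, rfl⟩ := Ioo_endpoints_eq (hab j).1 e2
    have hs := hscale j
    have h3 := (hab j).1
    nlinarith
  induction k with
  | zero =>
    refine ⟨1, δ / 2, by positivity, fun j => ⟨1, le_rfl, le_rfl, ?_, fun i hi => ?_⟩⟩
    · exact (T.isLevel (j + 3)).mapsTo T.fold (T.isLevel (j + 3)).mem_dom
    · obtain rfl : i = 0 := by omega
      exact hcenter (j + 3) _ (by positivity) (by linarith)
  | succ k ih =>
    obtain ⟨N, ε, hε, ih⟩ := ih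
    obtain ⟨s, hs, hsε⟩ := exists_foldLoss_lt (B / A) hε
    obtain ⟨M, hM⟩ := exists_nat_gt ((2 * C₁ + C₁ ^ 2) / s)
    set ε' := min (δ / 2) (min 1 (s / 3)) with hε'def
    have hε' : 0 < ε' := lt_min (by positivity) (lt_min one_pos (by positivity))
    have hε'δ : ε' < δ := (min_le_left _ _).trans_lt (by linarith)
    have hε's : 2 * ε' + ε' ^ 2 ≤ s := by
      have h1 : ε' ≤ 1 := (min_le_right _ _).trans (min_le_left _ _)
      have h2 : ε' ≤ s / 3 := (min_le_right _ _).trans (min_le_right _ _)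
      nlinarith
    have small : ∀ j x q t, 0 < t → t ≤ s → x ∈ (G (j + 3)).dom →
        (G (j + 2)).IsFirst ((G (j + 2)).piece c) x q →
        Space t ((G (j + 2)).hitSet c x q) (G (j + 2)).target →
        Space ε ((G (j + 3)).piece x) (G (j + 3)).target := by
      intro j x q t ht hts hx hq h
      exact (pull j x q s hs hx hq (h.mono ht hts)).mono (foldLoss_pos hκ (by positivity)) hsε.le
    refine ⟨N * M, ε', hε', fun j => ?_⟩
    obtain ⟨p, hp1, hpN, hpt, hp⟩ := ih (j + 1)
    have key : ∀ i ≤ p, ∃ P, i ≤ P ∧ P ≤ i * M ∧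
        (G (j + 3)).toFun^[P] c = (G (j + 4)).toFun^[i] c ∧
        ∀ t < P, ¬ Space ε' ((G (j + 3)).piece ((G (j + 3)).toFun^[t] c)) (G (j + 3)).target := by
      intro i
      induction i with
      | zero => exact fun _ => ⟨0, le_rfl, by simp, rfl, fun t ht => absurd ht (by omega)⟩
      | succ i ihi =>
        intro hi
        obtain ⟨P, hiP, hPM, hPe, hPs⟩ := ihi (by omega)
        set x := (G (j + 4)).toFun^[i] c with hx
        have hxd : x ∈ (G (j + 4)).dom := (T.isLevel (j + 4)).isRecurrent.1 i
        have hxs : ¬ Space ε ((G (j + 4)).piece x) (G (j + 4)).target := hp i (by omega)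
        obtain ⟨hxc, q, hq, hqe⟩ := hfirst (j + 3) x hxd
        have hqM : q ≤ M := by
          by_contra hcon
          push Not at hcon
          have hq0 : (0 : ℝ) < q := by exact_mod_cast hq.1.1
          refine hxs (small (j + 1) x q _ (by positivity) ?_ hxd hq
            ((T.isLevel (j + 3)).space_hitSet_of_time hC₁ hq fun y hy => hpieces j y hy))
          rw [div_le_iff₀ hq0]
          rw [div_lt_iff₀ hs] at hM
          have : (M : ℝ) ≤ q := by exact_mod_cast hcon.le
          nlinarith
        have hq1 := hq.1.1
        refine ⟨P + q, by omega, by rw [Nat.succ_mul]; omega, ?_, fun t ht => ?_⟩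
        · rw [add_comm P q, Function.iterate_add_apply, hPe, ← hqe, Function.iterate_succ_apply']
        · rcases Nat.lt_or_ge t P with h | h
          · exact hPs t h
          obtain ⟨v, rfl⟩ := Nat.exists_eq_add_of_le h
          rw [add_comm P v, Function.iterate_add_apply, hPe]
          rcases Nat.eq_zero_or_pos v with rfl | hv
          · rw [Function.iterate_zero, id, ← piece_eq_of_mem hxc]
            exact hcenter (j + 3) _ hε' hε'δ
          · obtain ⟨y, rfl⟩ : ∃ y, v = y + 1 := ⟨v - 1, by omega⟩
            exact fun hcon => hxs (small (j + 1) x q _ (by positivity) hε's hxd hq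
              ((T.isLevel (j + 3)).space_hitSet_of_visit hε' hq (by omega) hcon))
    obtain ⟨P, hpP, hPM, hPe, hPs⟩ := key p le_rfl
    refine ⟨P, hp1.trans hpP, hPM.trans (Nat.mul_le_mul_right M hpN), ?_, hPs⟩
    rw [hPe, show j + 3 + (k + 1) = j + 1 + 3 + k by ring]
    exact hpt

end PartialMap.Tower

namespace PartialMap

theorem level_succ (g : PartialMap) (c : ℝ) (n : ℕ) :
    g.level c (n + 1 + 1) = (g.level c (n + 1)).preRenorm c := by
  simp only [level, Nat.add_sub_cancel, Function.iterate_succ_apply']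

end PartialMap

theorem lemma4p4 (g : PartialMap) (c : ℝ) (hg : g.ClassT c) (hrec : g.IsRecurrent c)
    (hcentral : ∀ n : ℕ, 1 ≤ n → ¬ g.CentralReturn c n)
    (hscale : ∃ δ : ℝ, 0 < δ ∧ ∀ n : ℕ, 1 ≤ n → δ ≤ g.scalingFactor c n) :
    ∀ l : ℕ, ∃ C : ℕ, ∀ n : ℕ, l + 1 ≤ n → g.order c l n ≤ (C : ℕ∞) := by
  obtain ⟨f, l₀, r₀, E, u₀, w₀, H₀, F, L⟩ := hg.exists_isLevel hrec
  obtain ⟨u, w, û, ŵ, H, T⟩ := PartialMap.exists_tower F (G := fun n => g.level c (n + 1)) L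
    (g.level_succ c) (fun n => hcentral (n + 1) (by omega))
  obtain ⟨a, b, hab, hend⟩ := T.exists_endpoints
  have hnest : ∀ n, g.nest c n = (g.level c (n + 1)).target := by
    intro n
    rcases n with _ | n
    · rfl
    · rw [T.target_succ n]; rfl
  obtain ⟨δ, hδ, hs⟩ := hscale
  have hscale : ∀ n, δ * (b n - a n) ≤ b (n + 1) - a (n + 1) := by
    intro n
    have h := hs (n + 1) (by omega)
    have hv : ∀ m, volume.real (g.nest c m) = b m - a m := fun m => by
      rw [hnest, (hab m).2, Real.volume_real_Ioo_of_le (hab m).1.le]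
    rw [PartialMap.scalingFactor, Nat.add_sub_cancel, hv, hv,
      le_div_iff₀ (sub_pos.2 (hab n).1)] at h
    exact h
  intro l
  obtain ⟨N, ε, -, hN⟩ := T.exists_bounded_return hab hend hδ hscale (l + 1)
  have hret : ∀ j p, 1 ≤ p → (g.level c (j + 1)).toFun^[p] c ∈ g.nest c (j + l + 1) →
      g.order c l (j + l + 1) ≤ p := by
    intro j p hp hmem
    rw [PartialMap.order, show j + l + 1 - l = j + 1 by omega]
    exact PartialMap.IsReturn.returnTime_le ⟨hp, fun i _ => (T.isLevel j).isRecurrent.1 i, hmem⟩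
  have hfin : ∀ j, ∃ p : ℕ, g.order c l (j + l + 1) ≤ p := by
    intro j
    have hnhds : g.nest c (j + l + 1) ∈ 𝓝 c :=
      ((T.isLevel (j + l)).isOpen_piece c).mem_nhds (PartialMap.mem_piece (T.isLevel (j + l)).mem_dom)
    obtain ⟨p, hp, hmem⟩ := frequently_atTop.1
      (mapClusterPt_iff_frequently.1 (T.isLevel j).isRecurrent.2 _ hnhds) 1
    exact ⟨p, hret j p hp hmem⟩
  choose p hp using hfin
  refine ⟨N + (p 0 + p 1 + p 2), fun n hn => ?_⟩
  obtain ⟨j, rfl⟩ : ∃ j, n = j + l + 1 := ⟨n - l - 1, by omega⟩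
  rcases Nat.lt_or_ge j 3 with hj | hj
  · refine (hp j).trans ?_
    norm_cast
    interval_cases j <;> omega
  · obtain ⟨i, rfl⟩ := Nat.exists_eq_add_of_le' hj
    obtain ⟨q, hq1, hqN, hqm, -⟩ := hN i
    refine (hret (i + 3) q hq1 ?_).trans ?_
    · rw [hnest]; exact hqm
    · norm_cast; omega
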